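/- There are two agents and a set $O$ of $m$ indivisible items (chores). Agent $i\in\{1,2\}$ has a cost $c_i(o)\ge 0$ for each item $o\in O$; costs are additive, $c_i(S)=\sum_{o\in S}c_i(o)$ for $S\subseteq O$, and normalized, $c_i(O)=1$. An allocation $A=(A_1,A_2)$ is an ordered partition of $O$ into two, possibly empty, bundles; its social cost is $\mathsf{SC}(A)=c_1(A_1)+c_2(A_2)$. It is EQ1 (equitable up to one item) if for all agents $i,j$ either $A_i=\emptyset$ or there is an item $o\in A_i$ with $c_i(A_i\setminus\{o\})\le c_j(A_j)$. Let $\mathsf{OPT}^{EQ1}$ be the minimum of $\mathsf{SC}$ over all EQ1 allocations of the instance. Theorem 6. There is a deterministic algorithm (on a real random access machine, where each memory access, each addition, subtraction or comparison of natural numbers, and each arithmetic operation or comparison of real numbers takes one step) that, given an accuracy parameter $\varepsilon>0$ and an instance with two agents and $m$ items, halts after $O(m\,2^{2/\varepsilon})$ steps, with an absolute implied constant independent of $\varepsilon$, of $m$ and of the costs, and returns an EQ1 allocation $A$ with $\mathsf{SC}(A)\le \mathsf{OPT}^{EQ1}+\varepsilon$. -/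

import Mathlib

/-! ## Allocation of indivisible chores -/

/-- An instance with agents `Fin n`, items `Fin m` and normalized additive cost functions. An additive
cost function is determined by the nonnegative costs of the single items. -/
structure ChoreInstance (n m : ℕ) where
  /-- `itemCost i o` is the cost of item `o` for agent `i`. -/
  itemCost : Fin n → Fin m → ℝ
  itemCost_nonneg : ∀ i o, 0 ≤ itemCost i o
  normalized : ∀ i, ∑ o, itemCost i o = 1

/-- An allocation (an ordered partition of the items into `n` possibly empty bundles), given by the
agent that receives each item. -/
abbrev Allocation (n m : ℕ) : Type := Fin m → Fin n

/-- The set of items that agent `i` receives. -/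
def Allocation.bundle {n m : ℕ} (A : Allocation n m) (i : Fin n) : Finset (Fin m) :=
  Finset.univ.filter (fun o => A o = i)

namespace ChoreInstance

variable {n m : ℕ}

/-- The cost `c_i(S)` of a set of items. -/
noncomputable def cost (I : ChoreInstance n m) (i : Fin n) (S : Finset (Fin m)) : ℝ :=
  ∑ o ∈ S, I.itemCost i o

/-- The social cost of an allocation. -/
noncomputable def socialCost (I : ChoreInstance n m) (A : Allocation n m) : ℝ :=
  ∑ i, I.cost i (Allocation.bundle A i)

/-- Equitability up to one item. An agent with an empty bundle has cost `0` and nothing to remove;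
such an agent satisfies the condition. -/
def EQ1 (I : ChoreInstance n m) (A : Allocation n m) : Prop :=
  ∀ i j : Fin n, Allocation.bundle A i = ∅ ∨
    ∃ o ∈ Allocation.bundle A i,
      I.cost i (Allocation.bundle A i \ {o}) ≤ I.cost j (Allocation.bundle A j)

/-- The least social cost of an EQ1 allocation. -/
noncomputable def optEQ1 (I : ChoreInstance n m) : ℝ :=
  sInf {x : ℝ | ∃ A : Allocation n m, I.EQ1 A ∧ I.socialCost A = x}

end ChoreInstance

/-! ## A real random access machine with unit costs

Programs are deterministic structured programs over finitely many indirectly addressed arrays of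
natural numbers and of real numbers. Naturals (used for addresses and counters) can be added, subtracted
and compared; reals can be added, subtracted, multiplied, divided and compared. There is no conversion
from reals to naturals other than by comparisons. -/

namespace RealRAM

/-- The memory: `int a k` is cell `k` of the integer array `a`, and `real a k` is cell `k` of the
real array `a`. -/
structure State where
  int : ℕ → ℕ → ℕ
  real : ℕ → ℕ → ℝ

/-- Write `v` into cell `k` of the integer array `a`. -/
def State.setInt (s : State) (a k v : ℕ) : State where
  int := Function.update s.int a (Function.update (s.int a) k v)
  real := s.real

/-- Write `v` into cell `k` of the real array `a`. -/
noncomputable def State.setReal (s : State) (a k : ℕ) (v : ℝ) : State where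
  int := s.int
  real := Function.update s.real a (Function.update (s.real a) k v)

/-- Integer expressions. -/
inductive IntExpr : Type where
  /-- A constant. -/
  | const (k : ℕ) : IntExpr
  /-- The content of the cell of array `a` whose index is the value of `i`. -/
  | get (a : ℕ) (i : IntExpr) : IntExpr
  | add (e f : IntExpr) : IntExpr
  | sub (e f : IntExpr) : IntExpr

namespace IntExpr

/-- The value; subtraction is truncated at `0`. -/
def eval (s : State) : IntExpr → ℕ
  | const k => k
  | get a i => s.int a (i.eval s)
  | add e f => e.eval s + f.eval s
  | sub e f => e.eval s - f.eval s

/-- The number of steps of the evaluation: one per constant, memory access and operation. -/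
def steps : IntExpr → ℕ
  | const _ => 1
  | get _ i => i.steps + 1
  | add e f => e.steps + f.steps + 1
  | sub e f => e.steps + f.steps + 1

end IntExpr

/-- Real expressions. -/
inductive RealExpr : Type where
  /-- A natural number constant. -/
  | const (k : ℕ) : RealExpr
  /-- The content of the cell of array `a` whose index is the value of `i`. -/
  | get (a : ℕ) (i : IntExpr) : RealExpr
  | add (e f : RealExpr) : RealExpr
  | sub (e f : RealExpr) : RealExpr
  | mul (e f : RealExpr) : RealExpr
  | div (e f : RealExpr) : RealExpr

namespace RealExpr

/-- The value; a division by `0` returns `0`. -/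
noncomputable def eval (s : State) : RealExpr → ℝ
  | const k => (k : ℝ)
  | get a i => s.real a (i.eval s)
  | add e f => e.eval s + f.eval s
  | sub e f => e.eval s - f.eval s
  | mul e f => e.eval s * f.eval s
  | div e f => e.eval s / f.eval s

/-- The number of steps of the evaluation: one per constant, memory access and operation. -/
def steps : RealExpr → ℕ
  | const _ => 1
  | get _ i => i.steps + 1
  | add e f => e.steps + f.steps + 1
  | sub e f => e.steps + f.steps + 1
  | mul e f => e.steps + f.steps + 1
  | div e f => e.steps + f.steps + 1

end RealExpr

/-- Tests: exact comparisons of two integers or of two reals, and their Boolean combinations. -/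
inductive Test : Type where
  | intLT (e f : IntExpr) : Test
  | realLT (e f : RealExpr) : Test
  | not (b : Test) : Test
  | and (b c : Test) : Test

namespace Test

/-- Whether the test succeeds. -/
def Holds (s : State) : Test → Prop
  | intLT e f => e.eval s < f.eval s
  | realLT e f => e.eval s < f.eval s
  | not b => ¬ b.Holds s
  | and b c => b.Holds s ∧ c.Holds s

/-- The number of steps of the test. -/
def steps : Test → ℕ
  | intLT e f => e.steps + f.steps + 1
  | realLT e f => e.steps + f.steps + 1
  | not b => b.steps + 1
  | and b c => b.steps + c.steps + 1

end Test

/-- Programs. -/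
inductive Program : Type where
  | skip : Program
  /-- Write the value of `e` into the cell of integer array `a` whose index is the value of `i`. -/
  | setInt (a : ℕ) (i : IntExpr) (e : IntExpr) : Program
  /-- Write the value of `e` into the cell of real array `a` whose index is the value of `i`. -/
  | setReal (a : ℕ) (i : IntExpr) (e : RealExpr) : Program
  | seq (P Q : Program) : Program
  | ite (b : Test) (P Q : Program) : Program
  | while (b : Test) (P : Program) : Program

/-- `Exec P s s' t`: started in the memory state `s`, the program `P` halts in the state `s'`
after exactly `t` steps. -/
inductive Exec : Program → State → State → ℕ → Prop where
  | skip (s : State) : Exec Program.skip s s 1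
  | setInt (a : ℕ) (i e : IntExpr) (s : State) :
      Exec (Program.setInt a i e) s (s.setInt a (i.eval s) (e.eval s)) (i.steps + e.steps + 1)
  | setReal (a : ℕ) (i : IntExpr) (e : RealExpr) (s : State) :
      Exec (Program.setReal a i e) s (s.setReal a (i.eval s) (e.eval s)) (i.steps + e.steps + 1)
  | seq {P Q : Program} {s s' s'' : State} {t t' : ℕ} :
      Exec P s s' t → Exec Q s' s'' t' → Exec (Program.seq P Q) s s'' (t + t')
  | iteTrue {b : Test} {P Q : Program} {s s' : State} {t : ℕ} :
      b.Holds s → Exec P s s' t → Exec (Program.ite b P Q) s s' (b.steps + t)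
  | iteFalse {b : Test} {P Q : Program} {s s' : State} {t : ℕ} :
      ¬ b.Holds s → Exec Q s s' t → Exec (Program.ite b P Q) s s' (b.steps + t)
  | whileTrue {b : Test} {P : Program} {s s' s'' : State} {t t' : ℕ} :
      b.Holds s → Exec P s s' t → Exec (Program.while b P) s' s'' t' →
        Exec (Program.while b P) s s'' (b.steps + t + t')
  | whileFalse {b : Test} {P : Program} {s : State} :
      ¬ b.Holds s → Exec (Program.while b P) s s b.steps

/-- The initial memory for a two-agent instance and an accuracy parameter: the number of items is in
cell `0` of integer array `0`, the accuracy is in cell `0` of real array `0`, the item costs of the two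
agents are in the cells `0, …, m - 1` of the real arrays `1` and `2`, and all other cells are `0`. -/
noncomputable def input {m : ℕ} (I : ChoreInstance 2 m) (ε : ℝ) : State where
  int := fun a k => if a = 0 ∧ k = 0 then m else 0
  real := fun a k =>
    if a = 0 ∧ k = 0 then ε
    else if h : k < m then
      if a = 1 then I.itemCost 0 ⟨k, h⟩
      else if a = 2 then I.itemCost 1 ⟨k, h⟩
      else 0
    else 0

/-- The final memory describes the allocation `A`: cell `o` of integer array `1` holds the number
(`0` or `1`) of the agent that receives item `o`. -/
def IsOutput {m : ℕ} (s : State) (A : Allocation 2 m) : Prop :=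
  ∀ o : Fin m, s.int 1 (o : ℕ) = (A o : ℕ)

end RealRAM

/-! ### Execution of loop-free fragments and loops -/

namespace RealRAM

/-! Call an item large if its combined cost to both agents is at least `e = ε / (1 + ε)`. The
combined cost of all items is 2, so there are at most `2 / ε + 2` large items, and all their
assignments can be tried in `O(2 ^ (2 / ε))` rounds. For each one, only the cuts of a fixed order of
the small items are examined: a prefix goes to the first agent, the rest to the second. The order is
by decreasing ratio `(b - a) / (a + b)`, where `a` and `b` are the two costs of an item.

Cuts suffice by Lagrangian duality. Let the gap be the first agent's cost minus the second's. For a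
multiplier `s` in `[-1, 1]`, the expression total + `s` · gap separates over items and prefers the
first agent exactly when the ratio is at least `s`. A cut at an item of ratio `s` therefore
minimizes it among assignments with the same large part (`lagrangian_cut_le`, `exists_multiplier`).
Advancing a cut by one small item raises the gap by less than `e`, so some cut comes within `e` of
any gap between the extremes and costs at most about `e` more than an assignment with that gap. When
the gap jumps over zero, one of the two adjacent cuts is equitable up to the item just moved
(`valid_or_valid_succ`). `exists_valid_cut` combines these facts: every EQ1 assignment is matched,
up to `e + 2 * h`, by a cut satisfying `Valid`.

Exact sorting would cost a factor `log m`, so the ratios are only bucketed to width `h = ε² / (2 (1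
+ ε))`, which adds `2 * h` to the error. The choice gives `e + 2 * h = ε`, and the number of
buckets, of order `1 / h`, is `O(2 ^ (2 / ε))` (`sq_add_le_two_rpow`). Each bucket is one pass over
the items.

Each sweep of the cuts is linear in `m` because `Valid` can be maintained incrementally. The first
agent's bundle only grows, so its largest item is a running maximum. The second agent's bundle
shrinks, so only its large items and its first small item are consulted. `runs_scheme` joins the
combinatorics to the loop invariants of the program. -/

@[simp] theorem State.setInt_int_self (s : State) (a k v : ℕ) :
    (s.setInt a k v).int a = Function.update (s.int a) k v := by
  simp [State.setInt]

@[simp] theorem State.setInt_int_of_ne (s : State) {a b : ℕ} (k v : ℕ) (h : b ≠ a) :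
    (s.setInt a k v).int b = s.int b := by
  simp [State.setInt, h]

@[simp] theorem State.setInt_real (s : State) (a k v : ℕ) :
    (s.setInt a k v).real = s.real := rfl

@[simp] theorem State.setReal_real_self (s : State) (a k : ℕ) (v : ℝ) :
    (s.setReal a k v).real a = Function.update (s.real a) k v := by
  simp [State.setReal]

@[simp] theorem State.setReal_real_of_ne (s : State) {a b : ℕ} (k : ℕ) (v : ℝ) (h : b ≠ a) :
    (s.setReal a k v).real b = s.real b := by
  simp [State.setReal, h]

@[simp] theorem State.setReal_int (s : State) (a k : ℕ) (v : ℝ) :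
    (s.setReal a k v).int = s.int := rfl

namespace Program

/-- Programs without `while`. -/
def LoopFree : Program → Prop
  | skip => True
  | setInt _ _ _ => True
  | setReal _ _ _ => True
  | seq P Q => P.LoopFree ∧ Q.LoopFree
  | ite _ P Q => P.LoopFree ∧ Q.LoopFree
  | .while _ _ => False

open Classical in
/-- The final state of a loop-free program. -/
noncomputable def apply : Program → State → State
  | skip, s => s
  | setInt a i e, s => s.setInt a (i.eval s) (e.eval s)
  | setReal a i e, s => s.setReal a (i.eval s) (e.eval s)
  | seq P Q, s => Q.apply (P.apply s)
  | ite b P Q, s => if b.Holds s then P.apply s else Q.apply s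
  | .while _ _, s => s

theorem apply_seq (P Q : Program) (s : State) : (seq P Q).apply s = Q.apply (P.apply s) := rfl

theorem apply_ite_pos {b : Test} {s : State} (h : b.Holds s) (P Q : Program) :
    (ite b P Q).apply s = P.apply s := if_pos h

theorem apply_ite_neg {b : Test} {s : State} (h : ¬ b.Holds s) (P Q : Program) :
    (ite b P Q).apply s = Q.apply s := if_neg h

/-- An upper bound for the number of steps of a loop-free program. -/
def cost : Program → ℕ
  | skip => 1
  | setInt _ i e => i.steps + e.steps + 1
  | setReal _ i e => i.steps + e.steps + 1
  | seq P Q => P.cost + Q.cost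
  | ite b P Q => b.steps + (P.cost + Q.cost)
  | .while _ _ => 0

end Program

/-- `P`, started in `s`, halts within `T` steps in a state that satisfies `R`. -/
def Runs (P : Program) (s : State) (T : ℕ) (R : State → Prop) : Prop :=
  ∃ s' t, Exec P s s' t ∧ t ≤ T ∧ R s'

theorem Program.LoopFree.exec {P : Program} (hP : P.LoopFree) (s : State) :
    ∃ t ≤ P.cost, Exec P s (P.apply s) t := by
  induction P generalizing s with
  | skip => exact ⟨1, le_rfl, Exec.skip s⟩
  | setInt a i e => exact ⟨_, le_rfl, Exec.setInt a i e s⟩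
  | setReal a i e => exact ⟨_, le_rfl, Exec.setReal a i e s⟩
  | seq P Q ihP ihQ =>
    obtain ⟨t, ht, h⟩ := ihP hP.1 s
    obtain ⟨t', ht', h'⟩ := ihQ hP.2 (P.apply s)
    exact ⟨t + t', Nat.add_le_add ht ht', Exec.seq h h'⟩
  | ite b P Q ihP ihQ =>
    obtain ⟨t, ht, h⟩ := ihP hP.1 s
    obtain ⟨t', ht', h'⟩ := ihQ hP.2 s
    by_cases hb : b.Holds s
    · refine ⟨b.steps + t, ?_, ?_⟩
      · simp only [Program.cost]; omega
      · simpa [Program.apply, hb] using Exec.iteTrue hb h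
    · refine ⟨b.steps + t', ?_, ?_⟩
      · simp only [Program.cost]; omega
      · simpa [Program.apply, hb] using Exec.iteFalse hb h'
  | _ => exact hP.elim

/-- Reduces straight-line code to evaluating `apply`. The time bound charges both branches of every
conditional, so for a concrete fragment it is a closed numeral that `decide` can compare with the
allotted time. -/
theorem Program.LoopFree.runs {P : Program} (hP : P.LoopFree) {s : State} {R : State → Prop}
    (h : R (P.apply s)) : Runs P s P.cost R := by
  obtain ⟨t, ht, hx⟩ := hP.exec s
  exact ⟨_, t, hx, ht, h⟩

theorem Runs.mono {P : Program} {s : State} {T T' : ℕ} {R R' : State → Prop}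
    (h : Runs P s T R) (hT : T ≤ T') (hR : ∀ s', R s' → R' s') : Runs P s T' R' := by
  obtain ⟨s', t, hx, ht, hr⟩ := h
  exact ⟨s', t, hx, ht.trans hT, hR s' hr⟩

theorem Runs.seq {P Q : Program} {s : State} {T T' : ℕ} {R R' : State → Prop}
    (h : Runs P s T R) (h' : ∀ s', R s' → Runs Q s' T' R') : Runs (Program.seq P Q) s (T + T') R' := by
  obtain ⟨s', t, hx, ht, hr⟩ := h
  obtain ⟨s'', t', hx', ht', hr'⟩ := h' s' hr
  exact ⟨s'', _, Exec.seq hx hx', Nat.add_le_add ht ht', hr'⟩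

/-- A loop with an invariant indexed by the number of completed rounds, which stays below `N` as
long as the test succeeds. -/
theorem Runs.while {b : Test} {P : Program} {T : ℕ} (Inv : ℕ → State → Prop) (N : ℕ)
    (hbound : ∀ k s, Inv k s → b.Holds s → k < N)
    (hstep : ∀ k s, Inv k s → b.Holds s → Runs P s T (Inv (k + 1)))
    {k : ℕ} (hkN : k ≤ N) {s : State} (hs : Inv k s) :
    Runs (Program.while b P) s ((N - k) * (b.steps + T) + b.steps)
      (fun s' => ∃ j, k ≤ j ∧ Inv j s' ∧ ¬ b.Holds s') := by
  induction hd : N - k generalizing k s with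
  | zero =>
    have hb : ¬ b.Holds s := fun hb => by have := hbound k s hs hb; omega
    exact ⟨s, _, Exec.whileFalse hb, by omega, k, le_rfl, hs, hb⟩
  | succ d ih =>
    by_cases hb : b.Holds s
    · obtain ⟨s', t, hx, ht, hr⟩ := hstep k s hs hb
      obtain ⟨s'', t', hx', ht', j, hj, hr'⟩ := ih (by omega) hr (by omega)
      refine ⟨s'', _, Exec.whileTrue hb hx hx', ?_, j, by omega, hr'⟩
      have : (d + 1) * (b.steps + T) = d * (b.steps + T) + (b.steps + T) := Nat.succ_mul _ _
      omega
    · exact ⟨s, _, Exec.whileFalse hb, by omega, k, le_rfl, hs, hb⟩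

end RealRAM

/-! ### Cuts, equitability and the Lagrangian comparison -/

namespace TwoAgents

/-- The cost contributed by position `p` to the first agent; `α p` tells whether the second agent
receives it. -/
noncomputable def share₁ (a : ℕ → ℝ) (α : ℕ → Bool) (p : ℕ) : ℝ := if α p then 0 else a p

/-- The cost contributed by position `p` to the second agent. -/
noncomputable def share₂ (b : ℕ → ℝ) (α : ℕ → Bool) (p : ℕ) : ℝ := if α p then b p else 0

/-- The cost of the first agent on the positions below `k`. -/
noncomputable def load₁ (a : ℕ → ℝ) (α : ℕ → Bool) (k : ℕ) : ℝ := ∑ p ∈ Finset.range k, share₁ a α p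

/-- The cost of the second agent on the positions below `k`. -/
noncomputable def load₂ (b : ℕ → ℝ) (α : ℕ → Bool) (k : ℕ) : ℝ := ∑ p ∈ Finset.range k, share₂ b α p

/-- The maximum of `0` and the first `k` values of `f`. -/
noncomputable def peak (f : ℕ → ℝ) : ℕ → ℝ
  | 0 => 0
  | k + 1 => max (peak f k) (f k)

theorem peak_nonneg (f : ℕ → ℝ) (k : ℕ) : 0 ≤ peak f k := by
  induction k with
  | zero => exact le_rfl
  | succ k ih => exact ih.trans (le_max_left _ _)

theorem le_peak (f : ℕ → ℝ) {k p : ℕ} (h : p < k) : f p ≤ peak f k := by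
  induction k with
  | zero => omega
  | succ k ih =>
    rcases Nat.lt_succ_iff_lt_or_eq.mp h with h | rfl
    · exact (ih h).trans (le_max_left _ _)
    · exact le_max_right _ _

theorem peak_attained (f : ℕ → ℝ) (k : ℕ) : peak f k = 0 ∨ ∃ p < k, peak f k = f p := by
  induction k with
  | zero => exact Or.inl rfl
  | succ k ih =>
    rcases max_choice (peak f k) (f k) with h | h
    · rcases ih with h0 | ⟨p, hp, h1⟩
      · exact Or.inl (h.trans h0)
      · exact Or.inr ⟨p, by omega, h.trans h1⟩
    · exact Or.inr ⟨k, by omega, h⟩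

theorem peak_congr {f g : ℕ → ℝ} {k : ℕ} (h : ∀ p < k, f p = g p) : peak f k = peak g k := by
  induction k with
  | zero => rfl
  | succ k ih =>
    simp only [peak]
    rw [ih fun p hp => h p (by omega), h k (by omega)]

/-- The large positions, below `n`, are assigned by `τ`; the first agent receives the further
positions below `q` and the second agent the others. -/
def cut (n : ℕ) (τ : ℕ → Bool) (q : ℕ) (p : ℕ) : Bool := if p < n then τ p else decide (q ≤ p)

/-- Equitability up to one position. -/
def EQ1 (a b : ℕ → ℝ) (m : ℕ) (α : ℕ → Bool) : Prop :=
  (load₁ a α m ≤ load₂ b α m ∨ ∃ p < m, α p = false ∧ load₁ a α m - a p ≤ load₂ b α m) ∧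
  (load₂ b α m ≤ load₁ a α m ∨ ∃ p < m, α p = true ∧ load₂ b α m - b p ≤ load₁ a α m)

/-- A sufficient condition for the equitability of a cut that looks only at the items of the first
agent, at the large items of the second agent and at the first small item of the second agent. -/
def Valid (a b : ℕ → ℝ) (m n : ℕ) (τ : ℕ → Bool) (q : ℕ) : Prop :=
  load₁ a (cut n τ q) m - peak (share₁ a (cut n τ q)) q ≤ load₂ b (cut n τ q) m ∧
  (load₂ b (cut n τ q) m - peak (share₂ b (cut n τ q)) n ≤ load₁ a (cut n τ q) m ∨
    load₂ b (cut n τ q) m - b q ≤ load₁ a (cut n τ q) m)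

/-- The social cost. -/
noncomputable def total (a b : ℕ → ℝ) (m : ℕ) (α : ℕ → Bool) : ℝ := load₁ a α m + load₂ b α m

/-- The cost of the first agent minus the cost of the second agent. -/
noncomputable def gap (a b : ℕ → ℝ) (m : ℕ) (α : ℕ → Bool) : ℝ := load₁ a α m - load₂ b α m

theorem cut_congr {n : ℕ} {τ τ' : ℕ → Bool} (h : ∀ p < n, τ p = τ' p) (q : ℕ) :
    cut n τ q = cut n τ' q := by
  funext p
  unfold cut
  split_ifs with hp
  · exact h p hp
  · rfl

variable {a b : ℕ → ℝ} {m n : ℕ} {α τ : ℕ → Bool}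

theorem load₁_update {p : ℕ} (hp : p < m) (hα : α p = true) :
    load₁ a (Function.update α p false) m = load₁ a α m + a p := by
  have h : share₁ a (Function.update α p false) = Function.update (share₁ a α) p (a p) := by
    funext x
    by_cases hx : x = p
    · subst hx; simp [share₁]
    · simp [share₁, hx]
  have hs := Finset.sum_update_of_mem (Finset.mem_range.2 hp) (share₁ a α) (a p)
  have ht := Finset.sum_eq_add_sum_sdiff_singleton_of_mem (Finset.mem_range.2 hp) (share₁ a α)
  have h0 : share₁ a α p = 0 := by simp [share₁, hα]
  unfold load₁
  rw [h, hs, ht, h0]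
  ring

theorem load₂_update {p : ℕ} (hp : p < m) (hα : α p = true) :
    load₂ b (Function.update α p false) m = load₂ b α m - b p := by
  have h : share₂ b (Function.update α p false) = Function.update (share₂ b α) p 0 := by
    funext x
    by_cases hx : x = p
    · subst hx; simp [share₂]
    · simp [share₂, hx]
  have hs := Finset.sum_update_of_mem (Finset.mem_range.2 hp) (share₂ b α) 0
  have ht := Finset.sum_eq_add_sum_sdiff_singleton_of_mem (Finset.mem_range.2 hp) (share₂ b α)
  have h0 : share₂ b α p = b p := by simp [share₂, hα]
  unfold load₂
  rw [h, hs, ht, h0]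
  ring

theorem load₁_update_true {p : ℕ} (hp : p < m) (hα : α p = false) :
    load₁ a (Function.update α p true) m = load₁ a α m - a p := by
  have h := load₁_update (a := a) (α := Function.update α p true) hp (by simp)
  rw [Function.update_idem, ← hα, Function.update_eq_self] at h
  linarith

theorem load₂_update_true {p : ℕ} (hp : p < m) (hα : α p = false) :
    load₂ b (Function.update α p true) m = load₂ b α m + b p := by
  have h := load₂_update (b := b) (α := Function.update α p true) hp (by simp)
  rw [Function.update_idem, ← hα, Function.update_eq_self] at h
  linarith

theorem cut_succ {q : ℕ} (hq : n ≤ q) :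
    cut n τ (q + 1) = Function.update (cut n τ q) q false := by
  funext x
  by_cases hx : x = q
  · subst hx; simp [cut, hq]
  · simp only [cut, ne_eq, hx, not_false_eq_true, Function.update_of_ne]
    split_ifs with h
    · rfl
    · exact decide_eq_decide.2 (by omega)

theorem load₁_cut_succ {q : ℕ} (hq : n ≤ q) (hqm : q < m) :
    load₁ a (cut n τ (q + 1)) m = load₁ a (cut n τ q) m + a q := by
  rw [cut_succ hq, load₁_update hqm (by simp [cut, hq])]

theorem load₂_cut_succ {q : ℕ} (hq : n ≤ q) (hqm : q < m) :
    load₂ b (cut n τ (q + 1)) m = load₂ b (cut n τ q) m - b q := by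
  rw [cut_succ hq, load₂_update hqm (by simp [cut, hq])]

/-- A peak is zero or attained by some position, and that position is the item to remove. At `q = m`
there is no first small position; `b m = 0` then turns the last alternative of `Valid` into an
inequality that needs no removal. -/
theorem Valid.eq1 {q : ℕ} (hn : n ≤ q) (hq : q ≤ m) (hbm : b m = 0) (h : Valid a b m n τ q) :
    EQ1 a b m (cut n τ q) := by
  obtain ⟨h1, h2⟩ := h
  constructor
  · rcases peak_attained (share₁ a (cut n τ q)) q with h0 | ⟨p, hp, h0⟩
    · left; linarith
    · rw [h0] at h1
      unfold share₁ at h1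
      split_ifs at h1 with hc
      · left; linarith
      · exact Or.inr ⟨p, by omega, by simpa using hc, h1⟩
  · rcases h2 with h2 | h2
    · rcases peak_attained (share₂ b (cut n τ q)) n with h0 | ⟨p, hp, h0⟩
      · left; linarith
      · rw [h0] at h2
        unfold share₂ at h2
        split_ifs at h2 with hc
        · exact Or.inr ⟨p, by omega, hc, h2⟩
        · left; linarith
    · rcases hq.lt_or_eq with hlt | rfl
      · exact Or.inr ⟨q, hlt, by simp [cut, hn], h2⟩
      · left; linarith

theorem Valid.intro {q : ℕ}
    (h1 : gap a b m (cut n τ q) ≤ 0 ∨ ∃ p < q, cut n τ q p = false ∧ gap a b m (cut n τ q) ≤ a p)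
    (h2 : 0 ≤ gap a b m (cut n τ q) ∨ -gap a b m (cut n τ q) ≤ b q ∨
      ∃ p < n, cut n τ q p = true ∧ -gap a b m (cut n τ q) ≤ b p) :
    Valid a b m n τ q := by
  unfold gap at h1 h2
  constructor
  · rcases h1 with h1 | ⟨p, hp, hc, h1⟩
    · have := peak_nonneg (share₁ a (cut n τ q)) q
      linarith
    · have := le_peak (share₁ a (cut n τ q)) hp
      rw [show share₁ a (cut n τ q) p = a p by simp [share₁, hc]] at this
      linarith
  · rcases h2 with h2 | h2 | ⟨p, hp, hc, h2⟩
    · left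
      have := peak_nonneg (share₂ b (cut n τ q)) n
      linarith
    · right; linarith
    · left
      have := le_peak (share₂ b (cut n τ q)) hp
      rw [show share₂ b (cut n τ q) p = b p by simp [share₂, hc]] at this
      linarith

/-- Moving `q` to the first agent raises one load and lowers the other, so the gap moves by the full
weight of `q`, while the total changes only by the cost difference. -/
theorem gap_cut_succ {q : ℕ} (hq : n ≤ q) (hqm : q < m) :
    gap a b m (cut n τ (q + 1)) = gap a b m (cut n τ q) + (a q + b q) := by
  rw [gap, gap, load₁_cut_succ hq hqm, load₂_cut_succ hq hqm]; ring

theorem total_cut_succ {q : ℕ} (hq : n ≤ q) (hqm : q < m) :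
    total a b m (cut n τ (q + 1)) = total a b m (cut n τ q) - (b q - a q) := by
  rw [total, total, load₁_cut_succ hq hqm, load₂_cut_succ hq hqm]; ring

/-- The cut at `n` gives every small position to the second agent, which is the extreme case for the
gap once the large part is fixed. The cut at `m` is the opposite extreme. -/
theorem gap_cut_le (ha : ∀ p, 0 ≤ a p) (hb : ∀ p, 0 ≤ b p) (hα : ∀ p < n, α p = τ p) :
    gap a b m (cut n τ n) ≤ gap a b m α := by
  unfold gap load₁ load₂
  rw [← Finset.sum_sub_distrib, ← Finset.sum_sub_distrib]
  refine Finset.sum_le_sum fun p _ => ?_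
  have := ha p
  have := hb p
  by_cases hp : p < n
  · simp [share₁, share₂, cut, hp, hα p hp]
  · simp only [share₁, share₂, cut, hp, if_false, not_lt.1 hp, decide_true, if_true]
    split_ifs <;> linarith

theorem le_gap_cut (ha : ∀ p, 0 ≤ a p) (hb : ∀ p, 0 ≤ b p) (hα : ∀ p < n, α p = τ p) :
    gap a b m α ≤ gap a b m (cut n τ m) := by
  unfold gap load₁ load₂
  rw [← Finset.sum_sub_distrib, ← Finset.sum_sub_distrib]
  refine Finset.sum_le_sum fun p hpm => ?_
  have hpm := Finset.mem_range.1 hpm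
  have := ha p
  have := hb p
  by_cases hp : p < n
  · simp [share₁, share₂, cut, hp, hα p hp]
  · simp only [share₁, share₂, cut, hp, if_false, not_le.2 hpm, decide_false]
    split_ifs <;> first | linarith | simp_all

/-- Take the least `q` whose gap reaches `t`. If it is `n`, there is no preceding cut, hence the
separate alternative. Otherwise the strict jump also shows that the crossed item has positive
weight, so its ratio is meaningful. -/
theorem exists_crossing (hnm : n ≤ m) {t : ℝ} (h0 : gap a b m (cut n τ n) ≤ t)
    (h1 : t ≤ gap a b m (cut n τ m)) :
    gap a b m (cut n τ n) = t ∨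
      ∃ q, n ≤ q ∧ q < m ∧ gap a b m (cut n τ q) < t ∧ t ≤ gap a b m (cut n τ (q + 1)) := by
  classical
  have hex : ∃ q, n ≤ q ∧ t ≤ gap a b m (cut n τ q) := ⟨m, hnm, h1⟩
  have hs := Nat.find_spec hex
  have hle : Nat.find hex ≤ m := Nat.find_min' hex ⟨hnm, h1⟩
  rcases hs.1.eq_or_lt with he | hlt
  · left
    rw [← he] at hs
    exact le_antisymm h0 hs.2
  · right
    have hmin := Nat.find_min hex (m := Nat.find hex - 1) (by omega)
    refine ⟨Nat.find hex - 1, by omega, by omega, ?_, ?_⟩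
    · by_contra hc
      exact hmin ⟨by omega, not_lt.1 hc⟩
    · rw [Nat.sub_add_cancel (by omega)]
      exact hs.2

/-- The deficit before the jump and the surplus after it add up to `a q + b q`. So either the
deficit is at most `b q` and the second agent can drop `q`, or the surplus is at most `a q` and the
first agent can drop `q`. -/
theorem valid_or_valid_succ {q : ℕ} (hq : n ≤ q) (hqm : q < m)
    (h0 : gap a b m (cut n τ q) ≤ 0) (h1 : 0 ≤ gap a b m (cut n τ (q + 1))) :
    (Valid a b m n τ q ∧ -gap a b m (cut n τ q) ≤ b q) ∨
      (Valid a b m n τ (q + 1) ∧ gap a b m (cut n τ (q + 1)) ≤ a q) := by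
  have hs := gap_cut_succ (a := a) (b := b) (τ := τ) hq hqm
  by_cases h : -gap a b m (cut n τ q) ≤ b q
  · exact Or.inl ⟨Valid.intro (Or.inl h0) (Or.inr (Or.inl h)), h⟩
  · have h' : gap a b m (cut n τ (q + 1)) ≤ a q := by linarith
    refine Or.inr ⟨Valid.intro (Or.inr ⟨q, by omega, ?_, h'⟩) (Or.inl h1), h'⟩
    simp [cut, hq]

/-- A cut of approximately sorted positions approximately minimizes a Lagrangian. -/
theorem lagrangian_cut_le {s h : ℝ} {q : ℕ} (hh : 0 ≤ h) (ha : ∀ p, 0 ≤ a p) (hb : ∀ p, 0 ≤ b p)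
    (hsum : ∑ p ∈ Finset.range m, (a p + b p) ≤ 2) (hα : ∀ p < n, α p = τ p)
    (hlow : ∀ p, n ≤ p → p < q → p < m → (s - h) * (a p + b p) ≤ b p - a p)
    (hup : ∀ p, n ≤ p → q ≤ p → p < m → b p - a p ≤ (s + h) * (a p + b p)) :
    total a b m (cut n τ q) + s * gap a b m (cut n τ q) ≤
      total a b m α + s * gap a b m α + 2 * h := by
  -- The Lagrangian separates over positions. Bucketing misplaces a position by at most `h` in
  -- ratio, hence by `h * (a p + b p)` in value; these errors add up to at most `2 * h`.
  have key : ∑ p ∈ Finset.range m, ((share₁ a (cut n τ q) p + share₂ b (cut n τ q) p) +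
        s * (share₁ a (cut n τ q) p - share₂ b (cut n τ q) p)) ≤
      ∑ p ∈ Finset.range m, ((share₁ a α p + share₂ b α p) + s * (share₁ a α p - share₂ b α p) +
        h * (a p + b p)) := by
    refine Finset.sum_le_sum fun p hpm => ?_
    have hpm := Finset.mem_range.1 hpm
    have h0 : 0 ≤ h * (a p + b p) := mul_nonneg hh (add_nonneg (ha p) (hb p))
    by_cases hp : p < n
    · simp only [share₁, share₂, cut, hp, hα p hp, if_true]
      linarith
    · have hp' := not_lt.1 hp
      rcases lt_or_ge p q with hpq | hpq
      · have := hlow p hp' hpq hpm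
        simp only [share₁, share₂, cut, hp, if_false, not_le.2 hpq, decide_false]
        cases α p <;> simp <;> linarith
      · have := hup p hp' hpq hpm
        simp only [share₁, share₂, cut, hp, if_false, hpq, decide_true, if_true]
        cases α p <;> simp <;> linarith
  simp only [Finset.sum_add_distrib, ← Finset.mul_sum, Finset.sum_sub_distrib] at key
  rw [Finset.sum_add_distrib] at hsum
  unfold total gap load₁ load₂
  nlinarith [mul_le_mul_of_nonneg_left hsum hh]

/-- The multiplier is the exact ratio of the item at the cut. Chaining through the common level `θ`
shows that earlier ratios are at least `s - h` and later ones at most `s + h`. The exact equation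
for `q` makes the cuts at `q` and `q + 1` have the same Lagrangian value. -/
theorem exists_multiplier {h : ℝ} (hh : 0 ≤ h) (ha : ∀ p, 0 ≤ a p) (hb : ∀ p, 0 ≤ b p)
    (hsum : ∑ p ∈ Finset.range m, (a p + b p) ≤ 2)
    (hsort : ∀ p q, n ≤ p → p < q → q < m →
      ∃ θ : ℝ, θ * (a p + b p) ≤ b p - a p ∧ b q - a q ≤ (θ + h) * (a q + b q))
    {q : ℕ} (hq : n ≤ q) (hqm : q < m) (hw : 0 < a q + b q) :
    ∃ s : ℝ, -1 ≤ s ∧ s ≤ 1 ∧ b q - a q = s * (a q + b q) ∧ ∀ α : ℕ → Bool, (∀ p < n, α p = τ p) →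
      total a b m (cut n τ q) + s * gap a b m (cut n τ q) ≤
        total a b m α + s * gap a b m α + 2 * h := by
  have haq := ha q
  have hbq := hb q
  refine ⟨(b q - a q) / (a q + b q), ?_, ?_, ?_, ?_⟩
  · rw [le_div_iff₀ hw]; linarith
  · rw [div_le_iff₀ hw]; linarith
  · field_simp
  · intro α hα
    have hs : (b q - a q) / (a q + b q) * (a q + b q) = b q - a q := by field_simp
    refine lagrangian_cut_le hh ha hb hsum hα ?_ ?_
    · intro p hp hpq _
      obtain ⟨θ, h1, h2⟩ := hsort p q hp hpq hqm
      rw [← hs] at h2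
      have h3 := le_of_mul_le_mul_right h2 hw
      refine le_trans (mul_le_mul_of_nonneg_right ?_ (add_nonneg (ha p) (hb p))) h1
      linarith
    · intro p hp hpq hpm
      rcases hpq.eq_or_lt with rfl | hpq
      · rw [add_mul, hs]
        have := mul_nonneg hh hw.le
        linarith
      · obtain ⟨θ, h1, h2⟩ := hsort q p hq hpq hpm
        rw [← hs] at h1
        have h3 := le_of_mul_le_mul_right h1 hw
        refine h2.trans (mul_le_mul_of_nonneg_right ?_ (add_nonneg (ha p) (hb p)))
        linarith

/-- At multiplier 1 a position costs nothing with the second agent and `2 * a p` with the first, so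
the cut at `n` is optimal in any order. This serves the case where the desired gap already occurs at
`n` and no crossed item supplies a ratio. -/
theorem total_cut_start_add_gap_le {h : ℝ} (hh : 0 ≤ h) (ha : ∀ p, 0 ≤ a p) (hb : ∀ p, 0 ≤ b p)
    (hsum : ∑ p ∈ Finset.range m, (a p + b p) ≤ 2) (hα : ∀ p < n, α p = τ p) :
    total a b m (cut n τ n) + gap a b m (cut n τ n) ≤ total a b m α + gap a b m α + 2 * h := by
  have := lagrangian_cut_le (s := 1) (q := n) hh ha hb hsum hα (fun p h1 h2 => by omega)
    (fun p _ _ _ => by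
      have := mul_nonneg hh (add_nonneg (ha p) (hb p))
      have := ha p
      linarith)
  linarith

/-- Some valid cut with the large items placed as in a given EQ1 assignment is almost as cheap. -/
theorem exists_valid_cut {e h : ℝ} (he : 0 ≤ e) (hh : 0 ≤ h) (ha : ∀ p, 0 ≤ a p)
    (hb : ∀ p, 0 ≤ b p) (hsum : ∑ p ∈ Finset.range m, (a p + b p) ≤ 2) (hnm : n ≤ m)
    (hsmall : ∀ p, n ≤ p → p < m → a p + b p < e)
    (hsort : ∀ p q, n ≤ p → p < q → q < m →
      ∃ θ : ℝ, θ * (a p + b p) ≤ b p - a p ∧ b q - a q ≤ (θ + h) * (a q + b q))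
    (hα : EQ1 a b m α) :
    ∃ q, n ≤ q ∧ q ≤ m ∧ Valid a b m n α q ∧
      total a b m (cut n α q) ≤ total a b m α + e + 2 * h := by
  have hagree : ∀ p < n, α p = α p := fun _ _ => rfl
  have hg0 := gap_cut_le (m := m) ha hb hagree
  have hg1 := le_gap_cut (m := m) ha hb hagree
  have hstart := total_cut_start_add_gap_le hh ha hb hsum hagree
  -- A multiplier in `[-1, 1]` turns a gap difference of size at most `w` into a cost difference of
  -- at most `w`.
  have hmul : ∀ s z w : ℝ, -1 ≤ s → s ≤ 1 → -w ≤ z → z ≤ w → s * z ≤ w := fun s z w h1 h2 h3 h4 => by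
    nlinarith [mul_nonneg (sub_nonneg.2 h2) (by linarith : 0 ≤ z + w),
      mul_nonneg (by linarith : 0 ≤ s + 1) (sub_nonneg.2 h4)]
  -- cuts next to the gap of `α`
  have near : ∀ q, n ≤ q → q < m → gap a b m (cut n α q) < gap a b m α →
      gap a b m α ≤ gap a b m (cut n α (q + 1)) →
      total a b m (cut n α q) ≤ total a b m α + e + 2 * h ∧
      total a b m (cut n α (q + 1)) ≤ total a b m α + e + 2 * h := by
    intro q hq hqm h0 h1
    have hgs := gap_cut_succ (a := a) (b := b) (τ := α) hq hqm
    have hts := total_cut_succ (a := a) (b := b) (τ := α) hq hqm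
    obtain ⟨s, hs0, hs1, hd, hL⟩ :=
      exists_multiplier (τ := α) hh ha hb hsum hsort hq hqm (by linarith)
    have hL := hL α hagree
    have hw := hsmall q hq hqm
    have e1 := hmul s (gap a b m α - gap a b m (cut n α q)) (a q + b q) hs0 hs1
      (by linarith) (by linarith)
    have e2 := hmul s (gap a b m α - gap a b m (cut n α (q + 1))) (a q + b q) hs0 hs1
      (by linarith) (by linarith)
    rw [hgs] at e2
    constructor
    · linarith
    -- Since `s` is the ratio of `q`, handing `q` over leaves the Lagrangian unchanged, so `hL` also
    -- bounds the cut at `q + 1`.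
    · rw [hts, hd]; linarith
  rcases le_total 0 (gap a b m α) with hg | hg
  · have hwit : gap a b m α ≤ 0 ∨ ∃ p < m, α p = false ∧ gap a b m α ≤ a p := by
      rcases hα.1 with h1 | ⟨p, hp, hap, h1⟩
      · left; unfold gap; linarith
      · exact Or.inr ⟨p, hp, hap, by unfold gap; linarith⟩
    -- A large witness keeps its owner in every cut, so it certifies all cuts whose gap lies between
    -- zero and that of `α`; cutting next to the gap of `α` is then good enough.
    by_cases hlarge : gap a b m α ≤ 0 ∨ ∃ p < n, α p = false ∧ gap a b m α ≤ a p
    · have hval : ∀ q, n ≤ q → 0 ≤ gap a b m (cut n α q) →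
          gap a b m (cut n α q) ≤ gap a b m α → Valid a b m n α q := by
        intro q hq h0 h1
        refine Valid.intro ?_ (Or.inl h0)
        rcases hlarge with hl | ⟨p, hp, hap, hl⟩
        · left; linarith
        · exact Or.inr ⟨p, by omega, by simp [cut, hp, hap], h1.trans hl⟩
      rcases exists_crossing hnm hg0 hg1 with heq | ⟨q, hq, hqm, h0, h1⟩
      · exact ⟨n, le_rfl, hnm, hval n le_rfl (by linarith) (by linarith), by linarith⟩
      · obtain ⟨n1, n2⟩ := near q hq hqm h0 h1
        rcases le_total 0 (gap a b m (cut n α q)) with hz | hz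
        · exact ⟨q, hq, hqm.le, hval q hq hz h0.le, n1⟩
        · rcases valid_or_valid_succ hq hqm hz (by linarith) with hv | hv
          · exact ⟨q, hq, hqm.le, hv.1, n1⟩
          · exact ⟨q + 1, by omega, hqm, hv.1, n2⟩
    -- The only witnesses are small and may change hands in a cut, so the cut is made at gap zero
    -- instead. Moving a witness `o` to the second agent makes the gap at most `-b o ≤ 0`; this
    -- guarantees a crossing of zero and supplies a second assignment to compare with.
    · push Not at hlarge
      obtain ⟨o, ho, hao, hgo⟩ := hwit.resolve_left (not_le.2 hlarge.1)
      have hno : n ≤ o := by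
        by_contra hc
        exact absurd hgo (not_le.2 (hlarge.2 o (not_le.1 hc) hao))
      have hwo := hsmall o hno ho
      have hβ : ∀ p < n, Function.update α o true p = α p := fun p hp => by
        rw [Function.update_of_ne (by omega)]
      have hβg : gap a b m (Function.update α o true) = gap a b m α - (a o + b o) := by
        unfold gap
        rw [load₁_update_true ho hao, load₂_update_true ho hao]; ring
      have hβt : total a b m (Function.update α o true) = total a b m α + (b o - a o) := by
        unfold total
        rw [load₁_update_true ho hao, load₂_update_true ho hao]; ring
      have hβ0 := gap_cut_le (m := m) ha hb hβ
      have hbo := hb o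
      have hao' := ha o
      rcases exists_crossing (t := 0) hnm (by linarith) (hg.trans hg1) with
        heq | ⟨q, hq, hqm, h0, h1⟩
      · exact ⟨n, le_rfl, hnm, Valid.intro (Or.inl heq.le) (Or.inl heq.ge), by linarith⟩
      · have hgs := gap_cut_succ (a := a) (b := b) (τ := α) hq hqm
        have hts := total_cut_succ (a := a) (b := b) (τ := α) hq hqm
        obtain ⟨s, hs0, hs1, hd, hL⟩ :=
          exists_multiplier (τ := α) hh ha hb hsum hsort hq hqm (by linarith)
        have hLα := hL α hagree
        have hLβ := hL _ hβ
        rw [hβg, hβt] at hLβ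
        have hw := hsmall q hq hqm
        have haq := ha q
        have hbq := hb q
        rcases valid_or_valid_succ hq hqm h0.le h1 with ⟨hv, hvg⟩ | ⟨hv, hvg⟩
        · refine ⟨q, hq, hqm.le, hv, ?_⟩
          -- For `s ≥ 0`, compare with the modified assignment: moving `o` costs at most `(1 - s) *
          -- e` and the remaining deficit at most `s * e`, together `e`. For `s ≤ 0`, comparison
          -- with `α` suffices, because raising the gap does not raise the multiplier term.
          rcases le_total 0 s with hs | hs
          · have e1 : s * (gap a b m α - a o) ≤ 0 :=
              mul_nonpos_of_nonneg_of_nonpos hs (by linarith)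
            have e2 : s * -gap a b m (cut n α q) ≤ s * b q := mul_le_mul_of_nonneg_left hvg hs
            have e3 : s * b q ≤ s * e := mul_le_mul_of_nonneg_left (by linarith) hs
            have e4 : (1 - s) * b o ≤ (1 - s) * e :=
              mul_le_mul_of_nonneg_left (by linarith) (by linarith)
            linarith
          · have e1 : s * (gap a b m α - gap a b m (cut n α q)) ≤ 0 :=
              mul_nonpos_of_nonpos_of_nonneg hs (by linarith)
            linarith
        · refine ⟨q + 1, by omega, hqm, hv, ?_⟩
          -- Both gaps lie between zero and the cost of one small item, so they differ by at most
          -- `e`.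
          have e1 := hmul s (gap a b m α - gap a b m (cut n α (q + 1))) e hs0 hs1
            (by linarith) (by linarith)
          rw [hgs] at e1
          rw [hts, hd]
          linarith
  -- The mirror image: the agents are exchanged, and with them the two signs of `s`.
  · have hwit : 0 ≤ gap a b m α ∨ ∃ p < m, α p = true ∧ -gap a b m α ≤ b p := by
      rcases hα.2 with h1 | ⟨p, hp, hap, h1⟩
      · left; unfold gap; linarith
      · exact Or.inr ⟨p, hp, hap, by unfold gap; linarith⟩
    by_cases hlarge : 0 ≤ gap a b m α ∨ ∃ p < n, α p = true ∧ -gap a b m α ≤ b p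
    · have hval : ∀ q, n ≤ q → gap a b m (cut n α q) ≤ 0 →
          gap a b m α ≤ gap a b m (cut n α q) → Valid a b m n α q := by
        intro q hq h0 h1
        refine Valid.intro (Or.inl h0) ?_
        rcases hlarge with hl | ⟨p, hp, hap, hl⟩
        · left; linarith
        · exact Or.inr (Or.inr ⟨p, by omega, by simp [cut, hp, hap], by linarith⟩)
      rcases exists_crossing hnm hg0 hg1 with heq | ⟨q, hq, hqm, h0, h1⟩
      · exact ⟨n, le_rfl, hnm, hval n le_rfl (by linarith) (by linarith), by linarith⟩
      · obtain ⟨n1, n2⟩ := near q hq hqm h0 h1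
        rcases le_total (gap a b m (cut n α (q + 1))) 0 with hz | hz
        · exact ⟨q + 1, by omega, hqm, hval (q + 1) (by omega) hz h1, n2⟩
        · rcases valid_or_valid_succ hq hqm (by linarith) hz with hv | hv
          · exact ⟨q, hq, hqm.le, hv.1, n1⟩
          · exact ⟨q + 1, by omega, hqm, hv.1, n2⟩
    · push Not at hlarge
      obtain ⟨o, ho, hao, hgo⟩ := hwit.resolve_left (not_le.2 hlarge.1)
      have hno : n ≤ o := by
        by_contra hc
        exact absurd hgo (not_le.2 (hlarge.2 o (not_le.1 hc) hao))
      have hwo := hsmall o hno ho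
      have hβ : ∀ p < n, Function.update α o false p = α p := fun p hp => by
        rw [Function.update_of_ne (by omega)]
      have hβg : gap a b m (Function.update α o false) = gap a b m α + (a o + b o) := by
        unfold gap
        rw [load₁_update ho hao, load₂_update ho hao]; ring
      have hβt : total a b m (Function.update α o false) = total a b m α - (b o - a o) := by
        unfold total
        rw [load₁_update ho hao, load₂_update ho hao]; ring
      have hβ1 := le_gap_cut (m := m) ha hb hβ
      have hbo := hb o
      have hao' := ha o
      rcases exists_crossing (t := 0) hnm (by linarith) (by linarith) with
        heq | ⟨q, hq, hqm, h0, h1⟩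
      -- Gap zero cannot occur at the first cut, whose gap is at most that of `α`, which is negative
      -- here.
      · linarith
      · have hgs := gap_cut_succ (a := a) (b := b) (τ := α) hq hqm
        have hts := total_cut_succ (a := a) (b := b) (τ := α) hq hqm
        obtain ⟨s, hs0, hs1, hd, hL⟩ :=
          exists_multiplier (τ := α) hh ha hb hsum hsort hq hqm (by linarith)
        have hLα := hL α hagree
        have hLβ := hL _ hβ
        rw [hβg, hβt] at hLβ
        have hw := hsmall q hq hqm
        have haq := ha q
        have hbq := hb q
        rcases valid_or_valid_succ hq hqm h0.le h1 with ⟨hv, hvg⟩ | ⟨hv, hvg⟩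
        · refine ⟨q, hq, hqm.le, hv, ?_⟩
          have e1 := hmul s (gap a b m α - gap a b m (cut n α q)) e hs0 hs1
            (by linarith) (by linarith)
          linarith
        · refine ⟨q + 1, by omega, hqm, hv, ?_⟩
          rcases le_total s 0 with hs | hs
          · have e1 : -s * (-gap a b m α - b o) ≤ 0 :=
              mul_nonpos_of_nonneg_of_nonpos (by linarith) (by linarith)
            have e2 : -s * gap a b m (cut n α (q + 1)) ≤ -s * a q :=
              mul_le_mul_of_nonneg_left hvg (by linarith)
            have e3 : -s * a q ≤ -s * e := mul_le_mul_of_nonneg_left (by linarith) (by linarith)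
            have e4 : (1 + s) * a o ≤ (1 + s) * e :=
              mul_le_mul_of_nonneg_left (by linarith) (by linarith)
            rw [hgs] at e2
            rw [hts, hd]
            linarith
          · have e1 : s * (gap a b m α - gap a b m (cut n α (q + 1))) ≤ 0 :=
              mul_nonpos_of_nonneg_of_nonpos hs (by linarith)
            rw [hgs] at e1
            rw [hts, hd]
            linarith

/-- Treat all positions as small: the gap climbs from nonpositive to nonnegative, and one of the
cuts at the sign change is valid. No order of the ratios is needed. -/
theorem exists_eq1 (ha : ∀ p, 0 ≤ a p) (hb : ∀ p, 0 ≤ b p) (hbm : b m = 0) :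
    ∃ α, EQ1 a b m α := by
  have h0 : gap a b m (cut 0 (fun _ => true) 0) ≤ 0 := by
    have : load₁ a (cut 0 (fun _ => true) 0) m = 0 :=
      Finset.sum_eq_zero fun p _ => by simp [share₁, cut]
    have : 0 ≤ load₂ b (cut 0 (fun _ => true) 0) m :=
      Finset.sum_nonneg fun p _ => by unfold share₂; split_ifs <;> [exact hb p; exact le_rfl]
    unfold gap
    linarith
  have h1 : 0 ≤ gap a b m (cut 0 (fun _ => true) m) := by
    have : load₂ b (cut 0 (fun _ => true) m) m = 0 :=
      Finset.sum_eq_zero fun p hp => by simp [share₂, cut, Finset.mem_range.1 hp]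
    have : 0 ≤ load₁ a (cut 0 (fun _ => true) m) m :=
      Finset.sum_nonneg fun p _ => by unfold share₁; split_ifs <;> [exact le_rfl; exact ha p]
    unfold gap
    linarith
  rcases exists_crossing (Nat.zero_le m) h0 h1 with h | ⟨q, hq, hqm, hl, hr⟩
  · exact ⟨_, (Valid.intro (Or.inl h.le) (Or.inl h.ge)).eq1 le_rfl (Nat.zero_le m) hbm⟩
  · rcases valid_or_valid_succ hq hqm hl.le hr with h | h
    · exact ⟨_, h.1.eq1 hq hqm.le hbm⟩
    · exact ⟨_, h.1.eq1 (by omega) hqm hbm⟩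

end TwoAgents

/-! ### Named memory cells -/

namespace RealRAM

/-- The integer variable in cell `0` of array `a`. -/
abbrev ivar (a : ℕ) : IntExpr := IntExpr.get a (IntExpr.const 0)

/-- The real variable in cell `0` of array `a`. -/
abbrev rvar (a : ℕ) : RealExpr := RealExpr.get a (IntExpr.const 0)

/-- Assignment to an integer variable. -/
abbrev assignInt (a : ℕ) (e : IntExpr) : Program := Program.setInt a (IntExpr.const 0) e

/-- Assignment to a real variable. -/
abbrev assignReal (a : ℕ) (e : RealExpr) : Program := Program.setReal a (IntExpr.const 0) e

/-- Increment of an integer variable. -/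
abbrev incr (a : ℕ) : Program := assignInt a (IntExpr.add (ivar a) (IntExpr.const 1))

/-! ### Ordering the items -/

/-- Append item `i` (variable `5`) to the order: array `2` is the order, the real arrays `3` and `4`
are the costs in this order, array `4` flags the appended items and variable `6` counts them. -/
def appendItem : Program :=
  .seq (.setInt 2 (ivar 6) (ivar 5)) <|
  .seq (.setReal 3 (ivar 6) (.get 1 (ivar 5))) <|
  .seq (.setReal 4 (ivar 6) (.get 2 (ivar 5))) <|
  .seq (.setInt 4 (ivar 5) (.const 1)) (incr 6)

/-- Append all items that pass the test `b`. -/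
def scan (b : Test) : Program :=
  .seq (assignInt 5 (.const 0)) <|
  .while (.intLT (ivar 5) (ivar 0)) (.seq (.ite b appendItem .skip) (incr 5))

/-- The current item is large: its total cost is at least the real variable `5`. -/
def isLarge : Test := .not (.realLT (.add (.get 1 (ivar 5)) (.get 2 (ivar 5))) (rvar 5))

/-- The current item has not been appended, and the ratio of its cost difference and its total cost is
at least the real variable `7`. -/
def isNext : Test :=
  .and (.intLT (.get 4 (ivar 5)) (.const 1))
    (.not (.realLT (.sub (.get 2 (ivar 5)) (.get 1 (ivar 5)))
      (.mul (rvar 7) (.add (.get 1 (ivar 5)) (.get 2 (ivar 5))))))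

/-- Append the large items, store their number in variable `7`, and append the other items by
approximately decreasing ratio. -/
def arrange : Program :=
  .seq (scan isLarge) <|
  .seq (assignInt 7 (ivar 6)) <|
  .while (.intLT (ivar 6) (ivar 0))
    (.seq (scan isNext) (assignReal 7 (.sub (rvar 7) (rvar 6))))

/-- The memory while the items are being ordered; `l` is the list of the appended items. -/
structure Arranged (m : ℕ) (c₁ c₂ : ℕ → ℝ) (e h θ : ℝ) (n : ℕ) (l : List ℕ) (s : State) : Prop where
  size : s.int 0 0 = m
  cost₁ : s.real 1 = c₁
  cost₂ : s.real 2 = c₂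
  bound : s.real 5 0 = e
  width : s.real 6 0 = h
  level : s.real 7 0 = θ
  large : s.int 7 0 = n
  length : s.int 6 0 = l.length
  order : s.int 2 = fun k => l.getD k 0
  list₁ : s.real 3 = fun k => (l.map c₁).getD k 0
  list₂ : s.real 4 = fun k => (l.map c₂).getD k 0
  flag : s.int 4 = fun i => if i ∈ l then 1 else 0

/-- Unused cells hold the default value, so an array equals its list as a function on all indices,
and writing to the first free cell is appending. -/
theorem update_getD {β : Type*} (l : List β) (x d : β) :
    Function.update (fun k => l.getD k d) l.length x = fun k => (l ++ [x]).getD k d := by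
  funext k
  by_cases hk : k = l.length
  · subst hk; simp
  · rw [Function.update_of_ne hk]
    rcases lt_or_gt_of_ne hk with h | h
    · simp [List.getD_eq_getElem?_getD, List.getElem?_append_left h]
    · have h1 : l.length ≤ k := h.le
      have h2 : (l ++ [x]).length ≤ k := by simpa using h
      rw [List.getD_eq_default _ _ h1, List.getD_eq_default _ _ h2]

variable {m n : ℕ} {c₁ c₂ : ℕ → ℝ} {e h θ : ℝ} {l : List ℕ} {s : State}

theorem Arranged.appendItem (hs : Arranged m c₁ c₂ e h θ n l s) {i : ℕ} (hi : s.int 5 0 = i) :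
    Arranged m c₁ c₂ e h θ n (l ++ [i]) (appendItem.apply s) ∧
      (RealRAM.appendItem.apply s).int 5 0 = i := by
  refine ⟨⟨?_, ?_, ?_, ?_, ?_, ?_, ?_, ?_, ?_, ?_, ?_, ?_⟩, ?_⟩ <;>
    simp only [RealRAM.appendItem, Program.apply, IntExpr.eval, RealExpr.eval]
  · simp [hs.size]
  · simp [hs.cost₁]
  · simp [hs.cost₂]
  · simp [hs.bound]
  · simp [hs.width]
  · simp [hs.level]
  · simp [hs.large]
  · simp [hs.length]
  · simp [hs.length, hs.order, hi, -List.getD_eq_getElem?_getD, update_getD]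
  · have := update_getD (l.map c₁) (c₁ i) 0
    rw [List.length_map] at this
    simp [hs.length, hs.list₁, hs.cost₁, hi, -List.getD_eq_getElem?_getD, this]
  · have := update_getD (l.map c₂) (c₂ i) 0
    rw [List.length_map] at this
    simp [hs.length, hs.list₂, hs.cost₂, hi, -List.getD_eq_getElem?_getD, this]
  · funext k
    by_cases hk : k = i
    · subst hk; simp [hi]
    · simp [hs.flag, hi, hk]
  · simp [hi]

/-- A bound for the number of steps of a scan per item. -/
def scanCost (b : Test) : ℕ :=
  10 + (Test.intLT (ivar 5) (ivar 0)).steps + (b.steps + appendItem.cost)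

/-- The test has to agree with `P` at item `k` only in a memory where exactly the items below `k`
have been treated; this allows tests that read the flags the scan itself sets. -/
theorem Arranged.scan (hs : Arranged m c₁ c₂ e h θ n l s) (b : Test) (P : ℕ → Bool)
    (hb : ∀ k s, k < m → Arranged m c₁ c₂ e h θ n (l ++ (List.range k).filter P) s →
      s.int 5 0 = k → (b.Holds s ↔ P k = true)) :
    Runs (scan b) s (scanCost b * (m + 1))
      (Arranged m c₁ c₂ e h θ n (l ++ (List.range m).filter P)) := by
  have hinit : Runs (assignInt 5 (.const 0)) s (assignInt 5 (.const 0)).cost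
      (fun s => Arranged m c₁ c₂ e h θ n (l ++ (List.range 0).filter P) s ∧ s.int 5 0 = 0 ∧ 0 ≤ m) := by
    refine Program.LoopFree.runs (by trivial) ⟨?_, ?_, Nat.zero_le m⟩
    · rw [List.range_zero, List.filter_nil, List.append_nil]
      obtain ⟨h1, h2, h3, h4, h5, h6, h7, h8, h9, h10, h11, h12⟩ := hs
      exact ⟨h1, h2, h3, h4, h5, h6, h7, h8, h9, h10, h11, h12⟩
    · simp [Program.apply, IntExpr.eval]
  refine Runs.mono (Runs.seq (T' := m * ((Test.intLT (ivar 5) (ivar 0)).steps +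
      (Program.seq (.ite b RealRAM.appendItem .skip) (incr 5)).cost) +
      (Test.intLT (ivar 5) (ivar 0)).steps) hinit fun s hs => ?_) ?_ fun s hs => hs
  · refine (Runs.while (Inv := fun k s => Arranged m c₁ c₂ e h θ n (l ++ (List.range k).filter P) s ∧
      s.int 5 0 = k ∧ k ≤ m) m ?_ ?_ (Nat.zero_le m) hs).mono le_rfl ?_
    · rintro k s ⟨hs, hk, -⟩ ht
      simpa [Test.Holds, IntExpr.eval, hk, hs.size] using ht
    · rintro k s ⟨hs, hk, -⟩ ht
      have hkm : k < m := by simpa [Test.Holds, IntExpr.eval, hk, hs.size] using ht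
      have hbk := hb k s hkm hs hk
      refine Program.LoopFree.runs
        (by exact ⟨⟨⟨trivial, trivial, trivial, trivial, trivial⟩, trivial⟩, trivial⟩) ?_
      have key : ∀ s', Arranged m c₁ c₂ e h θ n (l ++ (List.range (k + 1)).filter P) s' →
          s'.int 5 0 = k → Arranged m c₁ c₂ e h θ n (l ++ (List.range (k + 1)).filter P)
            ((incr 5).apply s') ∧ ((incr 5).apply s').int 5 0 = k + 1 ∧ k + 1 ≤ m := by
        intro s' hs' hk'
        refine ⟨?_, ?_, hkm⟩
        · obtain ⟨h1, h2, h3, h4, h5, h6, h7, h8, h9, h10, h11, h12⟩ := hs'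
          exact ⟨h1, h2, h3, h4, h5, h6, h7, h8, h9, h10, h11, h12⟩
        · simp [Program.apply, IntExpr.eval, hk']
      rw [List.range_succ, List.filter_append] at key ⊢
      by_cases hB : b.Holds s
      · have hP := hbk.1 hB
        have := hs.appendItem hk
        rw [List.append_assoc] at this
        rw [Program.apply_seq, Program.apply_ite_pos hB]
        refine key _ ?_ this.2
        simpa [hP] using this.1
      · have hP : P k = false := by simpa using fun hc => hB (hbk.2 hc)
        rw [Program.apply_seq, Program.apply_ite_neg hB]
        refine key _ ?_ hk
        simpa [hP, Program.apply] using hs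
    · rintro s ⟨j, -, ⟨hs, hj, hjm⟩, ht⟩
      have : m ≤ j := by simpa [Test.Holds, IntExpr.eval, hj, hs.size] using ht
      obtain rfl : j = m := le_antisymm hjm this
      exact hs
  · have h1 : (assignInt 5 (.const 0)).cost = 3 := rfl
    have h2 : (Program.seq (.ite b RealRAM.appendItem .skip) (incr 5)).cost =
      b.steps + (RealRAM.appendItem.cost + 1) + 6 := rfl
    rw [h1, h2]
    unfold scanCost
    generalize (Test.intLT (ivar 5) (ivar 0)).steps = t
    generalize RealRAM.appendItem.cost = u
    nlinarith

/-- The small items after `j` passes. -/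
noncomputable def smallItems (m : ℕ) (c₁ c₂ : ℕ → ℝ) (h : ℝ) (l : List ℕ) : ℕ → List ℕ
  | 0 => []
  | j + 1 => smallItems m c₁ c₂ h l j ++ (List.range m).filter fun i =>
      i ∉ l ++ smallItems m c₁ c₂ h l j ∧ (1 - j * h) * (c₁ i + c₂ i) ≤ c₂ i - c₁ i

/-- The items of total cost at least `e`. -/
noncomputable def largeItems (m : ℕ) (c₁ c₂ : ℕ → ℝ) (e : ℝ) : List ℕ :=
  (List.range m).filter fun i => e ≤ c₁ i + c₂ i

theorem lt_of_mem_smallItems {j i : ℕ} (hi : i ∈ smallItems m c₁ c₂ h l j) : i < m := by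
  induction j with
  | zero => simp [smallItems] at hi
  | succ j ih =>
    rcases List.mem_append.1 hi with hi | hi
    · exact ih hi
    · exact List.mem_range.1 (List.mem_filter.1 hi).1

theorem nodup_append_smallItems (hl : l.Nodup) (j : ℕ) :
    (l ++ smallItems m c₁ c₂ h l j).Nodup := by
  induction j with
  | zero => simpa [smallItems] using hl
  | succ j ih =>
    rw [smallItems, ← List.append_assoc]
    refine List.Nodup.append ih (List.nodup_range.filter _) ?_
    intro i hi hi'
    have := (List.mem_filter.1 hi').2
    simp only [decide_eq_true_eq] at this
    exact this.1 hi

theorem le_of_mem_smallItems (hh : 0 ≤ h) (hc₁ : ∀ i, 0 ≤ c₁ i) (hc₂ : ∀ i, 0 ≤ c₂ i) {j i : ℕ}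
    (hi : i ∈ smallItems m c₁ c₂ h l j) : (1 - j * h) * (c₁ i + c₂ i) ≤ c₂ i - c₁ i := by
  have hw := add_nonneg (hc₁ i) (hc₂ i)
  induction j with
  | zero => simp [smallItems] at hi
  | succ j ih =>
    have hstep : (1 - ((j + 1 : ℕ) : ℝ) * h) * (c₁ i + c₂ i) ≤ (1 - j * h) * (c₁ i + c₂ i) := by
      refine mul_le_mul_of_nonneg_right ?_ hw
      push_cast
      linarith
    rcases List.mem_append.1 hi with hi | hi
    · exact hstep.trans (ih hi)
    · have := (List.mem_filter.1 hi).2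
      simp only [decide_eq_true_eq] at this
      exact hstep.trans this.2

/-- An item left after `j` passes failed the level of the previous pass, which is `h` above `1 - j *
h`. For `j = 0` the bound holds because no ratio exceeds 1. -/
theorem le_of_notMem_smallItems (hh : 0 ≤ h) (hc₁ : ∀ i, 0 ≤ c₁ i) (hc₂ : ∀ i, 0 ≤ c₂ i) {j i : ℕ}
    (him : i < m) (hi : i ∉ l ++ smallItems m c₁ c₂ h l j) :
    c₂ i - c₁ i ≤ (1 - j * h + h) * (c₁ i + c₂ i) := by
  have hw := mul_nonneg hh (add_nonneg (hc₁ i) (hc₂ i))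
  have h1 := hc₁ i
  cases j with
  | zero => push_cast; linarith
  | succ j =>
    simp only [smallItems, List.mem_append, List.mem_filter, List.mem_range, decide_eq_true_eq,
      not_or, not_and] at hi
    have := hi.2.2 him (by tauto)
    push_cast
    linarith

/-- The witness `θ` is the level of the pass that appended `q`: everything appended up to then lies
above it, and `q` exceeds it by at most `h`. Multiplying out the denominators also covers items of
zero cost. -/
theorem pairwise_smallItems (hh : 0 ≤ h) (hc₁ : ∀ i, 0 ≤ c₁ i) (hc₂ : ∀ i, 0 ≤ c₂ i) (j : ℕ) :
    (smallItems m c₁ c₂ h l j).Pairwise fun p q => ∃ θ : ℝ,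
      θ * (c₁ p + c₂ p) ≤ c₂ p - c₁ p ∧ c₂ q - c₁ q ≤ (θ + h) * (c₁ q + c₂ q) := by
  induction j with
  | zero => exact List.Pairwise.nil
  | succ j ih =>
    have hnew : ∀ i ∈ (List.range m).filter (fun i => i ∉ l ++ smallItems m c₁ c₂ h l j ∧
        (1 - j * h) * (c₁ i + c₂ i) ≤ c₂ i - c₁ i),
        (1 - j * h) * (c₁ i + c₂ i) ≤ c₂ i - c₁ i ∧
        c₂ i - c₁ i ≤ (1 - j * h + h) * (c₁ i + c₂ i) := by
      intro i hi
      obtain ⟨h1, h2⟩ := List.mem_filter.1 hi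
      simp only [decide_eq_true_eq] at h2
      exact ⟨h2.2, le_of_notMem_smallItems hh hc₁ hc₂ (List.mem_range.1 h1) h2.1⟩
    refine List.pairwise_append.2 ⟨ih, ?_, fun p hp q hq =>
      ⟨_, le_of_mem_smallItems hh hc₁ hc₂ hp, (hnew q hq).2⟩⟩
    exact List.pairwise_iff_forall_sublist.2 fun {p q} hpq => by
      have hsub := hpq.subset
      exact ⟨_, (hnew p (hsub (by simp))).1, (hnew q (hsub (by simp))).2⟩

/-- Levels start at 1 and drop by `h`, so after `N` drops the level is at most -1, which every item
passes. -/
theorem mem_of_two_le (hc₁ : ∀ i, 0 ≤ c₁ i) (hc₂ : ∀ i, 0 ≤ c₂ i) {N : ℕ}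
    (hN : 2 ≤ N * h) {j i : ℕ} (hj : N < j) (hh : 0 ≤ h) (him : i < m) :
    i ∈ l ++ smallItems m c₁ c₂ h l j := by
  by_contra hc
  obtain ⟨k, rfl⟩ := Nat.exists_eq_add_of_lt hj
  simp only [smallItems, List.mem_append, List.mem_filter, List.mem_range, decide_eq_true_eq,
    not_or, not_and] at hc
  refine hc.2.2 him (by tauto) ?_
  have h1 : 1 - ((N + k : ℕ) : ℝ) * h ≤ -1 := by
    push_cast
    have := mul_nonneg (Nat.cast_nonneg (α := ℝ) k) hh
    linarith
  have := mul_le_mul_of_nonneg_right h1 (add_nonneg (hc₁ i) (hc₂ i))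
  have := hc₂ i
  linarith

theorem Arranged.arrange {N : ℕ} (hh : 0 ≤ h) (hN : 2 ≤ N * h) (hc₁ : ∀ i, 0 ≤ c₁ i)
    (hc₂ : ∀ i, 0 ≤ c₂ i) (hs : Arranged m c₁ c₂ e h 1 0 [] s) :
    Runs arrange s ((scanCost isLarge + scanCost isNext + 30) * (N + 3) * (m + 1)) (fun s => ∃ j θ,
      Arranged m c₁ c₂ e h θ (largeItems m c₁ c₂ e).length
        (largeItems m c₁ c₂ e ++ smallItems m c₁ c₂ h (largeItems m c₁ c₂ e) j) s ∧
      m ≤ (largeItems m c₁ c₂ e ++ smallItems m c₁ c₂ h (largeItems m c₁ c₂ e) j).length) := by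
  set L := largeItems m c₁ c₂ e
  have hscan := hs.scan isLarge (fun i => decide (e ≤ c₁ i + c₂ i)) (by
    intro k s _ hs hk
    simp [isLarge, Test.Holds, RealExpr.eval, IntExpr.eval, hk, hs.cost₁, hs.cost₂, hs.bound])
  have hset : ∀ s, Arranged m c₁ c₂ e h 1 0 ([] ++ (List.range m).filter
      fun i => decide (e ≤ c₁ i + c₂ i)) s → Runs (assignInt 7 (ivar 6)) s
      (assignInt 7 (ivar 6)).cost (Arranged m c₁ c₂ e h (1 - (0 : ℕ) * h) L.length
        (L ++ smallItems m c₁ c₂ h L 0)) := by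
    intro s hs
    refine Program.LoopFree.runs (by trivial) ?_
    rw [List.nil_append] at hs
    change Arranged m c₁ c₂ e h 1 0 L s at hs
    obtain ⟨h1, h2, h3, h4, h5, h6, h7, h8, h9, h10, h11, h12⟩ := hs
    rw [smallItems, List.append_nil, Nat.cast_zero, zero_mul, sub_zero]
    exact ⟨h1, h2, h3, h4, h5, h6, h8, h8, h9, h10, h11, h12⟩
  have hloop : ∀ s, Arranged m c₁ c₂ e h (1 - (0 : ℕ) * h) L.length
      (L ++ smallItems m c₁ c₂ h L 0) s → Runs (.while (.intLT (ivar 6) (ivar 0))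
        (.seq (RealRAM.scan isNext) (assignReal 7 (.sub (rvar 7) (rvar 6))))) s
        ((N + 1 - 0) * ((Test.intLT (ivar 6) (ivar 0)).steps + (scanCost isNext * (m + 1) +
          (assignReal 7 (.sub (rvar 7) (rvar 6))).cost)) + (Test.intLT (ivar 6) (ivar 0)).steps)
        (fun s => ∃ j, 0 ≤ j ∧ Arranged m c₁ c₂ e h (1 - (j : ℕ) * h) L.length
          (L ++ smallItems m c₁ c₂ h L j) s ∧ ¬ (Test.intLT (ivar 6) (ivar 0)).Holds s) := by
    intro s hs
    refine Runs.while (Inv := fun j s => Arranged m c₁ c₂ e h (1 - (j : ℕ) * h) L.length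
      (L ++ smallItems m c₁ c₂ h L j) s) (N + 1) ?_ ?_ (Nat.zero_le _) hs
    · intro j s hs ht
      simp only [Test.Holds, IntExpr.eval, hs.size, hs.length] at ht
      -- After `N + 1` passes the list contains all `m` items, so by counting its length is no
      -- longer below `m` and the loop test fails.
      by_contra hj
      have : (List.range m).length ≤ (L ++ smallItems m c₁ c₂ h L j).length :=
        (List.subperm_of_subset List.nodup_range fun i hi =>
          mem_of_two_le hc₁ hc₂ hN (by omega) hh (List.mem_range.1 hi)).length_le
      rw [List.length_range] at this
      omega
    · intro j s hs ht
      have hsc := hs.scan isNext (fun i => decide (i ∉ L ++ smallItems m c₁ c₂ h L j ∧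
          (1 - j * h) * (c₁ i + c₂ i) ≤ c₂ i - c₁ i)) (by
        intro k s _ hs hk
        simp only [isNext, Test.Holds, RealExpr.eval, IntExpr.eval, hk, hs.cost₁, hs.cost₂, hs.flag,
          hs.level, not_lt, decide_eq_true_eq]
        -- Items appended earlier in the same pass are below `k`, so the flag of `k` still reflects
        -- the list at the start of the pass.
        refine and_congr ?_ Iff.rfl
        simp)
      refine hsc.seq fun s hs => Program.LoopFree.runs (by trivial) ?_
      rw [List.append_assoc] at hs
      change Arranged m c₁ c₂ e h (1 - (j : ℕ) * h) L.length
        (L ++ smallItems m c₁ c₂ h L (j + 1)) s at hs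
      obtain ⟨h1, h2, h3, h4, h5, h6, h7, h8, h9, h10, h11, h12⟩ := hs
      refine ⟨h1, h2, h3, h4, h5, ?_, h7, h8, h9, h10, h11, h12⟩
      simp only [Program.apply, IntExpr.eval, RealExpr.eval, State.setReal_real_self,
        Function.update_self, h5, h6]
      push_cast
      ring
  refine (hscan.seq fun s hs => (hset s hs).seq fun s hs => hloop s hs).mono ?_ ?_
  · have h1 : (assignInt 7 (ivar 6)).cost = 4 := rfl
    have h2 : (assignReal 7 (.sub (rvar 7) (rvar 6))).cost = 7 := rfl
    have h3 : (Test.intLT (ivar 6) (ivar 0)).steps = 5 := rfl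
    rw [h1, h2, h3, Nat.sub_zero]
    generalize scanCost isLarge = t
    generalize scanCost isNext = u
    have e1 : t * (m + 1) ≤ t * (N + 3) * (m + 1) := by nlinarith [Nat.zero_le (t * (m + 1) * (N + 2))]
    have e2 : (N + 1) * (u * (m + 1)) ≤ u * (N + 3) * (m + 1) := by
      nlinarith [Nat.zero_le (u * (m + 1))]
    have e3 : (N + 1) * 12 + 9 ≤ 30 * (N + 3) * (m + 1) := by nlinarith [Nat.zero_le (N * m)]
    nlinarith
  · rintro s ⟨j, -, hs, ht⟩
    refine ⟨j, _, hs, ?_⟩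
    simpa only [Test.Holds, IntExpr.eval, hs.size, hs.length, not_lt] using ht

end RealRAM

namespace RealRAM

open TwoAgents

/-! ### Searching for the best cut -/

/-- Store the powers of two up to exponent `n` (variable `7`) in array `3`. -/
def powers : Program :=
  .seq (assignInt 10 (.const 0)) <|
  .seq (assignInt 3 (.const 1)) <|
  .while (.intLT (ivar 10) (ivar 7))
    (.seq (.setInt 3 (.add (ivar 10) (.const 1)) (.add (.get 3 (ivar 10)) (.get 3 (ivar 10))))
      (incr 10))

/-- The power of two that belongs to the current large position (variable `10`). -/
abbrev currentPower : IntExpr := .get 3 (.sub (.sub (ivar 7) (.const 1)) (ivar 10))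

/-- The bit of the current large position in the number with remainder in variable `9` is `0`. -/
abbrev bitIsZero : Test := .intLT (ivar 9) currentPower

/-- Give the current position to the first agent: update the costs of the agents (variables `8` and
`9`) and the largest cost in the first bundle (variable `10`). -/
def giveFirst : Program :=
  .seq (assignReal 8 (.add (rvar 8) (.get 3 (ivar 10)))) <|
  .seq (assignReal 9 (.sub (rvar 9) (.get 4 (ivar 10)))) <|
  .ite (.realLT (rvar 10) (.get 3 (ivar 10))) (assignReal 10 (.get 3 (ivar 10))) .skip

/-- Give the current large position to the second agent: update the remainder and the largest cost
in the second bundle (variable `11`). -/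
def giveSecond : Program :=
  .seq (assignInt 9 (.sub (ivar 9) currentPower)) <|
  .ite (.realLT (rvar 11) (.get 4 (ivar 10))) (assignReal 11 (.get 4 (ivar 10))) .skip

/-- Assign the large positions according to the bits of variable `8`. -/
def assignLarge : Program :=
  .seq (.seq (assignReal 8 (.const 0)) <| .seq (assignReal 9 (.const 1)) <|
    .seq (assignReal 10 (.const 0)) <| .seq (assignReal 11 (.const 0)) <|
    .seq (assignInt 9 (ivar 8)) (assignInt 10 (.const 0))) <|
  .while (.intLT (ivar 10) (ivar 7)) (.seq (.ite bitIsZero giveFirst giveSecond) (incr 10))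

/-- The current cut is valid and cheaper than the best cost so far (variable `12`). -/
def isBetter : Test :=
  .and (.not (.realLT (rvar 9) (.sub (rvar 8) (rvar 10)))) <|
  .and (.not (.and (.realLT (rvar 8) (.sub (rvar 9) (rvar 11)))
    (.realLT (rvar 8) (.sub (rvar 9) (.get 4 (ivar 10))))))
  (.realLT (.add (rvar 8) (rvar 9)) (rvar 12))

/-- Store the current cut as the best one. -/
def record : Program :=
  .seq (assignReal 12 (.add (rvar 8) (rvar 9))) <|
  .seq (assignInt 11 (ivar 8)) (assignInt 12 (ivar 10))

/-- Try all cuts of the small positions. -/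
def sweep : Program :=
  .while (.intLT (ivar 10) (.add (ivar 0) (.const 1)))
    (.seq (.ite isBetter record .skip) (.seq giveFirst (incr 10)))

/-- Try all assignments of the large positions and all cuts of the small ones. -/
def search : Program :=
  .seq (.seq (assignInt 8 (.const 0)) (assignReal 12 (.const 3))) <|
  .while (.intLT (ivar 8) (.get 3 (ivar 7))) (.seq assignLarge (.seq sweep (incr 8)))

/-- Write the agent `k` of the current position into the output. -/
abbrev emit (k : ℕ) : Program := .setInt 1 (.get 2 (ivar 10)) (.const k)

/-- Write the best cut into the output. -/
def output : Program :=
  .seq (.seq (assignInt 9 (ivar 11)) (assignInt 10 (.const 0))) <|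
  .while (.intLT (ivar 10) (ivar 0)) <|
    .seq (.ite (.intLT (ivar 10) (ivar 7))
      (.ite bitIsZero (emit 0) (.seq (emit 1) (assignInt 9 (.sub (ivar 9) currentPower))))
      (.ite (.intLT (ivar 10) (ivar 12)) (emit 0) (emit 1))) (incr 10)

/-- The memory after the items have been ordered. -/
structure Ordered (m n : ℕ) (o : ℕ → ℕ) (a b : ℕ → ℝ) (s : State) : Prop where
  size : s.int 0 0 = m
  large : s.int 7 0 = n
  order : s.int 2 = o
  list₁ : s.real 3 = a
  list₂ : s.real 4 = b

/-- The memory during the search. -/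
structure Searching (m n : ℕ) (o : ℕ → ℕ) (a b : ℕ → ℝ) (r rem p : ℕ) (x y u v best : ℝ)
    (rb qb : ℕ) (s : State) : Prop extends Ordered m n o a b s where
  pow : ∀ k ≤ n, s.int 3 k = 2 ^ k
  round : s.int 8 0 = r
  remainder : s.int 9 0 = rem
  pos : s.int 10 0 = p
  cost₁ : s.real 8 0 = x
  cost₂ : s.real 9 0 = y
  peak₁ : s.real 10 0 = u
  peak₂ : s.real 11 0 = v
  best : s.real 12 0 = best
  bestRound : s.int 11 0 = rb
  bestCut : s.int 12 0 = qb

variable {m n : ℕ} {o : ℕ → ℕ} {a b : ℕ → ℝ} {r rem p : ℕ} {x y u v best : ℝ} {rb qb : ℕ} {s : State}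

theorem Ordered.powers (hs : Ordered m n o a b s) :
    Runs powers s (30 * (n + 1)) (fun s => Ordered m n o a b s ∧ ∀ k ≤ n, s.int 3 k = 2 ^ k) := by
  have hstart : Runs (assignInt 10 (.const 0)) s 3 (fun s => Ordered m n o a b s ∧ s.int 10 0 = 0) := by
    refine Program.LoopFree.runs (P := assignInt 10 (.const 0)) trivial ⟨?_, by
      simp [Program.apply, IntExpr.eval]⟩
    obtain ⟨h1, h2, h3, h4, h5⟩ := hs
    exact ⟨h1, h2, h3, h4, h5⟩
  have hone : ∀ s, (Ordered m n o a b s ∧ s.int 10 0 = 0) → Runs (assignInt 3 (.const 1)) s 3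
      (fun s => Ordered m n o a b s ∧ s.int 10 0 = 0 ∧ 0 ≤ n ∧ ∀ j ≤ 0, s.int 3 j = 2 ^ j) := by
    rintro s ⟨⟨h1, h2, h3, h4, h5⟩, hp⟩
    refine Program.LoopFree.runs (P := assignInt 3 (.const 1)) trivial
      ⟨⟨h1, h2, h3, h4, h5⟩, hp, Nat.zero_le n, fun j hj => ?_⟩
    obtain rfl : j = 0 := by omega
    simp [Program.apply, IntExpr.eval]
  refine (hstart.seq fun s hs => (hone s hs).seq fun s hs => Runs.while (T := 18)
    (fun k s => Ordered m n o a b s ∧ s.int 10 0 = k ∧ k ≤ n ∧ ∀ j ≤ k, s.int 3 j = 2 ^ j)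
    n ?_ ?_ (Nat.zero_le n) hs).mono ?_ ?_
  · rintro k s ⟨hs, hk, -⟩ ht
    simpa [Test.Holds, IntExpr.eval, hk, hs.large] using ht
  · rintro k s ⟨hs, hk, -, hpow⟩ ht
    have hkn : k < n := by simpa [Test.Holds, IntExpr.eval, hk, hs.large] using ht
    refine Runs.mono (Program.LoopFree.runs (by exact ⟨trivial, trivial⟩)
      (R := fun s => Ordered m n o a b s ∧ s.int 10 0 = k + 1 ∧ k + 1 ≤ n ∧
        ∀ j ≤ k + 1, s.int 3 j = 2 ^ j) ⟨?_, ?_, hkn, fun j hj => ?_⟩) (by decide) fun s hs => hs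
    · obtain ⟨h1, h2, h3, h4, h5⟩ := hs
      exact ⟨h1, h2, h3, h4, h5⟩
    · simp [Program.apply, IntExpr.eval, hk]
    · rcases hj.eq_or_lt with rfl | hj
      · simp [Program.apply, IntExpr.eval, hk, hpow k le_rfl]
        ring
      · simp [Program.apply, IntExpr.eval, hk, hj.ne, hpow j (by omega)]
  · simp only [show (Test.intLT (ivar 10) (ivar 7)).steps = 5 from rfl]
    omega
  · rintro s ⟨j, -, ⟨hs, hj, hjn, hpow⟩, ht⟩
    have : n ≤ j := by simpa [Test.Holds, IntExpr.eval, hj, hs.large] using ht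
    exact ⟨hs, fun k hk => hpow k (by omega)⟩

theorem Searching.incr (hs : Searching m n o a b r rem p x y u v best rb qb s) :
    Searching m n o a b r rem (p + 1) x y u v best rb qb ((incr 10).apply s) := by
  obtain ⟨⟨h1, h2, h3, h4, h5⟩, h6, h7, h8, h9, h10, h11, h12, h13, h14, h15, h16⟩ := hs
  refine ⟨⟨h1, h2, h3, h4, h5⟩, h6, h7, h8, ?_, h10, h11, h12, h13, h14, h15, h16⟩
  simp [Program.apply, IntExpr.eval, h9]

theorem Searching.giveFirst (hs : Searching m n o a b r rem p x y u v best rb qb s) :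
    Searching m n o a b r rem p (x + a p) (y - b p) (max u (a p)) v best rb qb
      (giveFirst.apply s) := by
  obtain ⟨⟨h1, h2, h3, h4, h5⟩, h6, h7, h8, h9, h10, h11, h12, h13, h14, h15, h16⟩ := hs
  rw [RealRAM.giveFirst, Program.apply_seq, Program.apply_seq]
  set s' := (assignReal 9 (.sub (rvar 9) (.get 4 (ivar 10)))).apply
    ((assignReal 8 (.add (rvar 8) (.get 3 (ivar 10)))).apply s) with hs'
  have hs1 : Searching m n o a b r rem p (x + a p) (y - b p) u v best rb qb s' := by
    refine ⟨⟨h1, h2, h3, h4, h5⟩, h6, h7, h8, h9, ?_, ?_, h12, h13, h14, h15, h16⟩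
    · simp [hs', Program.apply, IntExpr.eval, RealExpr.eval, h9, h10, h4]
    · simp [hs', Program.apply, IntExpr.eval, RealExpr.eval, h9, h11, h5]
  clear_value s'
  obtain ⟨⟨h1, h2, h3, h4, h5⟩, h6, h7, h8, h9, h10, h11, h12, h13, h14, h15, h16⟩ := hs1
  have hiff : (Test.realLT (rvar 10) (.get 3 (ivar 10))).Holds s' ↔ u < a p := by
    simp [Test.Holds, IntExpr.eval, RealExpr.eval, h4, h9, h12]
  by_cases hlt : u < a p
  · rw [Program.apply_ite_pos (hiff.2 hlt), max_eq_right hlt.le]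
    refine ⟨⟨h1, h2, h3, h4, h5⟩, h6, h7, h8, h9, h10, h11, ?_, h13, h14, h15, h16⟩
    simp [Program.apply, IntExpr.eval, RealExpr.eval, h9, h4]
  · rw [Program.apply_ite_neg (fun hc => hlt (hiff.1 hc)), max_eq_left (not_lt.1 hlt)]
    exact ⟨⟨h1, h2, h3, h4, h5⟩, h6, h7, h8, h9, h10, h11, h12, h13, h14, h15, h16⟩

theorem Searching.eval_currentPower (hs : Searching m n o a b r rem p x y u v best rb qb s) :
    currentPower.eval s = 2 ^ (n - 1 - p) := by
  simp only [IntExpr.eval, hs.large, hs.pos]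
  exact hs.pow _ (by omega)

theorem Searching.giveSecond (hs : Searching m n o a b r rem p x y u v best rb qb s) :
    Searching m n o a b r (rem - 2 ^ (n - 1 - p)) p x y u (max v (b p)) best rb qb
      (giveSecond.apply s) := by
  have hpw := hs.eval_currentPower
  obtain ⟨⟨h1, h2, h3, h4, h5⟩, h6, h7, h8, h9, h10, h11, h12, h13, h14, h15, h16⟩ := hs
  rw [RealRAM.giveSecond, Program.apply_seq]
  set s' := (assignInt 9 (.sub (ivar 9) currentPower)).apply s with hs'
  have hs1 : Searching m n o a b r (rem - 2 ^ (n - 1 - p)) p x y u v best rb qb s' := by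
    refine ⟨⟨h1, h2, h3, h4, h5⟩, h6, h7, ?_, h9, h10, h11, h12, h13, h14, h15, h16⟩
    have he : (IntExpr.sub (ivar 9) currentPower).eval s = rem - 2 ^ (n - 1 - p) := by
      rw [← hpw, ← h8]; rfl
    rw [hs', Program.apply, he]
    simp [IntExpr.eval]
  clear_value s'
  obtain ⟨⟨h1, h2, h3, h4, h5⟩, h6, h7, h8, h9, h10, h11, h12, h13, h14, h15, h16⟩ := hs1
  have hiff : (Test.realLT (rvar 11) (.get 4 (ivar 10))).Holds s' ↔ v < b p := by
    simp [Test.Holds, IntExpr.eval, RealExpr.eval, h5, h9, h13]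
  by_cases hlt : v < b p
  · rw [Program.apply_ite_pos (hiff.2 hlt), max_eq_right hlt.le]
    refine ⟨⟨h1, h2, h3, h4, h5⟩, h6, h7, h8, h9, h10, h11, h12, ?_, h14, h15, h16⟩
    simp [Program.apply, IntExpr.eval, RealExpr.eval, h9, h5]
  · rw [Program.apply_ite_neg (fun hc => hlt (hiff.1 hc)), max_eq_left (not_lt.1 hlt)]
    exact ⟨⟨h1, h2, h3, h4, h5⟩, h6, h7, h8, h9, h10, h11, h12, h13, h14, h15, h16⟩

/-- The assignment of the large positions that the number `r` encodes. -/
def bits (n r p : ℕ) : Bool := r.testBit (n - 1 - p)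

/-- The remainder modulo `2 ^ (n - p)` retains the bits of positions `p, …, n - 1`, with position
`p` on top. Comparison with the top power reads its bit and subtraction clears it, so decoding needs
no division. -/
theorem mod_lt_iff_bits (hp : p < n) : r % 2 ^ (n - p) < 2 ^ (n - 1 - p) ↔ bits n r p = false := by
  rw [show n - p = n - 1 - p + 1 by omega, Nat.mod_pow_succ, bits, Nat.testBit_eq_decide_div_mod_eq]
  have := Nat.mod_lt r (Nat.two_pow_pos (n - 1 - p))
  rcases Nat.mod_two_eq_zero_or_one (r / 2 ^ (n - 1 - p)) with h | h <;> simp [h, this]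

theorem mod_of_bits_eq_false (hp : p < n) (h : bits n r p = false) :
    r % 2 ^ (n - (p + 1)) = r % 2 ^ (n - p) := by
  rw [bits, Nat.testBit_eq_decide_div_mod_eq, decide_eq_false_iff_not] at h
  rw [show n - p = n - 1 - p + 1 by omega, Nat.mod_pow_succ,
    show n - (p + 1) = n - 1 - p by omega]
  rw [show r / 2 ^ (n - 1 - p) % 2 = 0 by omega]
  simp

theorem mod_of_bits_eq_true (hp : p < n) (h : bits n r p = true) :
    r % 2 ^ (n - (p + 1)) = r % 2 ^ (n - p) - 2 ^ (n - 1 - p) := by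
  rw [bits, Nat.testBit_eq_decide_div_mod_eq, decide_eq_true_eq] at h
  rw [show n - p = n - 1 - p + 1 by omega, Nat.mod_pow_succ,
    show n - (p + 1) = n - 1 - p by omega, h]
  simp

theorem exists_bits_eq (n : ℕ) (α : ℕ → Bool) : ∃ r < 2 ^ n, ∀ p < n, bits n r p = α p := by
  refine ⟨Nat.ofBits fun i : Fin n => α (n - 1 - i), Nat.ofBits_lt_two_pow _, fun p hp => ?_⟩
  rw [bits, Nat.testBit_ofBits_lt _ _ (by omega)]
  congr 1
  change n - 1 - (n - 1 - p) = p
  omega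

/-- The number being decoded need not be the current round, because the output phase decodes the
stored best round. -/
theorem Searching.holds_bitIsZero
    (hs : Searching m n o a b r (rb % 2 ^ (n - p)) p x y u v best qb rem s) (hp : p < n) :
    bitIsZero.Holds s ↔ bits n rb p = false := by
  rw [← mod_lt_iff_bits hp, bitIsZero, Test.Holds, hs.eval_currentPower]
  simp [IntExpr.eval, hs.remainder]

/-- The second cost register starts at 1, the cost of all items, and loses what the first agent
receives. The small positions are thus already counted for the second agent, ready for the cut at
`n`. -/
theorem Searching.assignLarge (hs : Searching m n o a b r rem p x y u v best rb qb s)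
    (hr : r < 2 ^ n) :
    Runs assignLarge s (100 * (n + 1)) (Searching m n o a b r 0 n (load₁ a (bits n r) n)
      (1 - load₁ b (bits n r) n) (peak (share₁ a (bits n r)) n) (peak (share₂ b (bits n r)) n)
      best rb qb) := by
  have hstart : Runs (.seq (assignReal 8 (.const 0)) <| .seq (assignReal 9 (.const 1)) <|
    .seq (assignReal 10 (.const 0)) <| .seq (assignReal 11 (.const 0)) <|
    .seq (assignInt 9 (ivar 8)) (assignInt 10 (.const 0))) s 19
      (fun s => Searching m n o a b r (r % 2 ^ (n - 0)) 0 (load₁ a (bits n r) 0)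
        (1 - load₁ b (bits n r) 0) (peak (share₁ a (bits n r)) 0) (peak (share₂ b (bits n r)) 0)
        best rb qb s ∧ 0 ≤ n) := by
    refine Program.LoopFree.runs (P := .seq (assignReal 8 (.const 0)) <|
      .seq (assignReal 9 (.const 1)) <| .seq (assignReal 10 (.const 0)) <|
      .seq (assignReal 11 (.const 0)) <| .seq (assignInt 9 (ivar 8)) (assignInt 10 (.const 0)))
      (by exact ⟨trivial, trivial, trivial, trivial, trivial, trivial⟩) ⟨?_, Nat.zero_le n⟩
    obtain ⟨⟨h1, h2, h3, h4, h5⟩, h6, h7, h8, h9, h10, h11, h12, h13, h14, h15, h16⟩ := hs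
    refine ⟨⟨h1, h2, h3, h4, h5⟩, h6, h7, ?_, ?_, ?_, ?_, ?_, ?_, h14, h15, h16⟩ <;>
      simp [Program.apply, IntExpr.eval, RealExpr.eval, load₁, peak, h7, Nat.mod_eq_of_lt hr]
  refine (hstart.seq fun s hs => Runs.while (T := 90) (fun k s =>
    Searching m n o a b r (r % 2 ^ (n - k)) k (load₁ a (bits n r) k)
        (1 - load₁ b (bits n r) k) (peak (share₁ a (bits n r)) k) (peak (share₂ b (bits n r)) k)
        best rb qb s ∧ k ≤ n) n ?_ ?_ (Nat.zero_le n) hs).mono ?_ ?_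
  · rintro k s ⟨hs, -⟩ ht
    simpa [Test.Holds, IntExpr.eval, hs.pos, hs.large] using ht
  · rintro k s ⟨hs, -⟩ ht
    have hkn : k < n := by simpa [Test.Holds, IntExpr.eval, hs.pos, hs.large] using ht
    have hbit := hs.holds_bitIsZero hkn
    refine Runs.mono (Program.LoopFree.runs (by
      exact ⟨⟨⟨trivial, trivial, trivial, trivial⟩, trivial, trivial, trivial⟩, trivial⟩)
      (R := fun s => Searching m n o a b r (r % 2 ^ (n - (k + 1))) (k + 1)
        (load₁ a (bits n r) (k + 1)) (1 - load₁ b (bits n r) (k + 1))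
        (peak (share₁ a (bits n r)) (k + 1)) (peak (share₂ b (bits n r)) (k + 1))
        best rb qb s ∧ k + 1 ≤ n) ⟨?_, hkn⟩) (by decide) fun s hs => hs
    rw [Program.apply_seq]
    have l1 : ∀ c : ℕ → ℝ, load₁ c (bits n r) (k + 1) =
        load₁ c (bits n r) k + share₁ c (bits n r) k := fun c => Finset.sum_range_succ _ _
    rw [l1, l1, peak, peak]
    cases hB : bits n r k with
    | false =>
      rw [Program.apply_ite_pos (hbit.2 hB)]
      have h := hs.giveFirst.incr
      rw [mod_of_bits_eq_false hkn hB]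
      simp only [share₁, share₂, hB]
      rw [if_neg (by simp), if_neg (by simp), if_neg (by simp), max_eq_left (peak_nonneg _ k),
        ← sub_sub]
      exact h
    | true =>
      rw [Program.apply_ite_neg (fun hc => by simp [hbit.1 hc] at hB)]
      have h := hs.giveSecond.incr
      rw [mod_of_bits_eq_true hkn hB]
      simp only [share₁, share₂, hB]
      simp only [if_true, add_zero, max_eq_left (peak_nonneg _ k)]
      exact h
  · simp only [show (Test.intLT (ivar 10) (ivar 7)).steps = 5 from rfl]
    omega
  · rintro s ⟨j, -, ⟨hs, hjn⟩, ht⟩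
    have : n ≤ j := by simpa [Test.Holds, IntExpr.eval, hs.pos, hs.large] using ht
    obtain rfl : j = n := le_antisymm hjn this
    rw [Nat.sub_self, pow_zero, Nat.mod_one] at hs
    exact hs

/-- The stored cut is the best valid one among those that satisfy `D`. -/
structure IsBest (a b : ℕ → ℝ) (m n : ℕ) (D : ℕ → ℕ → Prop) (best : ℝ) (rb qb : ℕ) : Prop where
  le : ∀ r q, D r q → n ≤ q → q ≤ m → Valid a b m n (bits n r) q →
    best ≤ total a b m (cut n (bits n r) q)
  attained : best = 3 ∨ (rb < 2 ^ n ∧ n ≤ qb ∧ qb ≤ m ∧ Valid a b m n (bits n rb) qb ∧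
    total a b m (cut n (bits n rb) qb) = best)

theorem load₁_cut_start (hnm : n ≤ m) (τ : ℕ → Bool) (c : ℕ → ℝ) :
    load₁ c (cut n τ n) m = load₁ c τ n := by
  unfold load₁
  rw [← Finset.sum_subset (Finset.range_subset_range.2 hnm)]
  · refine Finset.sum_congr rfl fun p hp => ?_
    simp [share₁, cut, Finset.mem_range.1 hp]
  · intro p _ hp
    rw [Finset.mem_range] at hp
    simp [share₁, cut, hp, not_lt.1 hp]

theorem load₂_eq (b : ℕ → ℝ) (m : ℕ) (α : ℕ → Bool) :
    load₂ b α m = ∑ p ∈ Finset.range m, b p - load₁ b α m := by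
  unfold load₁ load₂
  rw [← Finset.sum_sub_distrib]
  refine Finset.sum_congr rfl fun p _ => ?_
  unfold share₁ share₂
  split_ifs <;> simp

theorem peak₂_cut (τ : ℕ → Bool) (q : ℕ) :
    peak (share₂ b (cut n τ q)) n = peak (share₂ b τ) n :=
  peak_congr fun p hp => by simp [share₂, cut, hp]

/-- Advancing the cut only adds to the first bundle, so a running maximum is enough. The second
bundle loses items, and only its peak over large positions stays fixed. -/
theorem peak₁_cut_succ (τ : ℕ → Bool) {q : ℕ} (hq : n ≤ q) :
    peak (share₁ a (cut n τ (q + 1))) (q + 1) = max (peak (share₁ a (cut n τ q)) q) (a q) := by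
  rw [peak]
  congr 1
  · refine peak_congr fun p hp => ?_
    unfold share₁ cut
    rw [decide_eq_decide.2 (show q + 1 ≤ p ↔ q ≤ p by omega)]
  · simp [share₁, cut, hq]

theorem Searching.holds_isBetter (hs : Searching m n o a b r rem p x y u v best rb qb s) :
    isBetter.Holds s ↔ x - u ≤ y ∧ (y - v ≤ x ∨ y - b p ≤ x) ∧ x + y < best := by
  simp only [isBetter, Test.Holds, RealExpr.eval, IntExpr.eval, hs.cost₁, hs.cost₂, hs.peak₁,
    hs.peak₂, hs.list₂, hs.pos, hs.best, not_lt, not_and_or]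

theorem Searching.record (hs : Searching m n o a b r rem p x y u v best rb qb s) :
    Searching m n o a b r rem p x y u v (x + y) r p (record.apply s) := by
  obtain ⟨⟨h1, h2, h3, h4, h5⟩, h6, h7, h8, h9, h10, h11, h12, h13, h14, h15, h16⟩ := hs
  refine ⟨⟨h1, h2, h3, h4, h5⟩, h6, h7, h8, h9, h10, h11, h12, h13, ?_, ?_, ?_⟩ <;>
    simp [RealRAM.record, Program.apply, IntExpr.eval, RealExpr.eval, h7, h9, h10, h11]

theorem Searching.sweep (hsb : ∑ p ∈ Finset.range m, b p = 1) (hnm : n ≤ m) (hr : r < 2 ^ n)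
    (hs : Searching m n o a b r 0 n (load₁ a (bits n r) n)
      (1 - load₁ b (bits n r) n) (peak (share₁ a (bits n r)) n) (peak (share₂ b (bits n r)) n)
      best rb qb s) (hbest : IsBest a b m n (fun r' _ => r' < r) best rb qb) :
    Runs sweep s (120 * (m + 1)) (fun s => ∃ p x y u v best rb qb,
      Searching m n o a b r 0 p x y u v best rb qb s ∧
      IsBest a b m n (fun r' _ => r' < r + 1) best rb qb) := by
  set τ := bits n r with hτ
  have htest : (Test.intLT (ivar 10) (.add (ivar 0) (.const 1))).steps = 7 := rfl
  -- The round that tests the cut at `m` still hands over the nonexistent position `m`, so the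
  -- registers are described only for `k ≤ m`.
  refine (Runs.while (T := 93) (fun k s => k ≤ m + 1 ∧ n ≤ k ∧ ∃ x y u best rb qb,
    Searching m n o a b r 0 k x y u (peak (share₂ b τ) n) best rb qb s ∧
    (k ≤ m → x = load₁ a (cut n τ k) m ∧ y = load₂ b (cut n τ k) m ∧
      u = peak (share₁ a (cut n τ k)) k) ∧
    IsBest a b m n (fun r' q => r' < r ∨ r' = r ∧ q < k) best rb qb) (m + 1) ?_ ?_
      (k := n) (by omega) (s := s) ?_).mono ?_ ?_
  · rintro k s ⟨-, -, x, y, u, best, rb, qb, hs, -⟩ ht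
    simpa [Test.Holds, IntExpr.eval, hs.pos, hs.size] using ht
  · rintro k s ⟨-, hnk, x, y, u, best, rb, qb, hs, hval, hbest⟩ ht
    have hkm : k < m + 1 := by simpa [Test.Holds, IntExpr.eval, hs.pos, hs.size] using ht
    obtain ⟨hx, hy, hu⟩ := hval (by omega)
    have hvalid : Valid a b m n τ k ↔ x - u ≤ y ∧
        (y - peak (share₂ b τ) n ≤ x ∨ y - b k ≤ x) := by
      rw [Valid, peak₂_cut, ← hx, ← hy, ← hu]
    have hnext : ∀ x' y' u' best' rb' qb' s', x' = x → y' = y → u' = u →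
        Searching m n o a b r 0 k x' y' u' (peak (share₂ b τ) n) best' rb' qb' s' →
        IsBest a b m n (fun r' q => r' < r ∨ r' = r ∧ q < k + 1) best' rb' qb' →
        k + 1 ≤ m + 1 ∧ n ≤ k + 1 ∧ ∃ x y u best rb qb,
          Searching m n o a b r 0 (k + 1) x y u (peak (share₂ b τ) n) best rb qb
            ((Program.seq RealRAM.giveFirst (RealRAM.incr 10)).apply s') ∧
          (k + 1 ≤ m → x = load₁ a (cut n τ (k + 1)) m ∧ y = load₂ b (cut n τ (k + 1)) m ∧
            u = peak (share₁ a (cut n τ (k + 1))) (k + 1)) ∧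
          IsBest a b m n (fun r' q => r' < r ∨ r' = r ∧ q < k + 1) best rb qb := by
      rintro x' y' u' best' rb' qb' s' rfl rfl rfl hs' hb'
      refine ⟨hkm, by omega, _, _, _, _, _, _, hs'.giveFirst.incr, fun hk => ?_, hb'⟩
      rw [load₁_cut_succ hnk (by omega), load₂_cut_succ hnk (by omega), peak₁_cut_succ τ hnk,
        hx, hy, hu]
      exact ⟨rfl, rfl, rfl⟩
    refine Runs.mono (Program.LoopFree.runs (by
      exact ⟨⟨⟨trivial, trivial, trivial⟩, trivial⟩, ⟨trivial, trivial, trivial, trivial⟩, trivial⟩)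
      (R := fun s => k + 1 ≤ m + 1 ∧ n ≤ k + 1 ∧ ∃ x y u best rb qb,
          Searching m n o a b r 0 (k + 1) x y u (peak (share₂ b τ) n) best rb qb s ∧
          (k + 1 ≤ m → x = load₁ a (cut n τ (k + 1)) m ∧ y = load₂ b (cut n τ (k + 1)) m ∧
            u = peak (share₁ a (cut n τ (k + 1))) (k + 1)) ∧
          IsBest a b m n (fun r' q => r' < r ∨ r' = r ∧ q < k + 1) best rb qb) ?_) (by decide)
      fun s hs => hs
    rw [Program.apply_seq]
    have htotal : total a b m (cut n τ k) = x + y := by rw [total, hx, hy]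
    by_cases hB : isBetter.Holds s
    · obtain ⟨h1, h2, h3⟩ := hs.holds_isBetter.1 hB
      rw [Program.apply_ite_pos hB]
      refine hnext _ _ _ _ _ _ _ rfl rfl rfl hs.record ⟨?_, ?_⟩
      · intro r' q hD hq hqm hv
        rcases hD with hD | ⟨rfl, hD⟩
        · exact h3.le.trans (hbest.le r' q (Or.inl hD) hq hqm hv)
        · rcases Nat.lt_succ_iff_lt_or_eq.1 hD with hD | rfl
          · exact h3.le.trans (hbest.le _ q (Or.inr ⟨rfl, hD⟩) hq hqm hv)
          · exact htotal.ge
      · exact Or.inr ⟨hr, hnk, by omega, hvalid.2 ⟨h1, h2⟩, htotal⟩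
    · rw [Program.apply_ite_neg hB]
      refine hnext _ _ _ _ _ _ _ rfl rfl rfl hs ⟨?_, hbest.attained⟩
      intro r' q hD hq hqm hv
      rcases hD with hD | ⟨rfl, hD⟩
      · exact hbest.le r' q (Or.inl hD) hq hqm hv
      · rcases Nat.lt_succ_iff_lt_or_eq.1 hD with hD | rfl
        · exact hbest.le _ q (Or.inr ⟨rfl, hD⟩) hq hqm hv
        · obtain ⟨h1, h2⟩ := hvalid.1 hv
          have := not_lt.1 fun hc => hB (hs.holds_isBetter.2 ⟨h1, h2, hc⟩)
          exact this.trans htotal.ge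
  · refine ⟨by omega, le_rfl, _, _, _, _, _, _, hs, fun _ => ⟨?_, ?_, ?_⟩, ?_⟩
    · rw [load₁_cut_start hnm]
    · rw [load₂_eq, load₁_cut_start hnm, hsb]
    · exact peak_congr fun p hp => by simp [share₁, cut, hp]
    · refine ⟨fun r' q hD hq hqm hv => ?_, hbest.attained⟩
      rcases hD with hD | ⟨-, hD⟩
      · exact hbest.le r' q hD hq hqm hv
      · omega
  · rw [htest]
    have : (m + 1 - n) * (7 + 93) ≤ (m + 1) * (7 + 93) := Nat.mul_le_mul_right _ (by omega)
    omega
  · rintro s ⟨j, -, ⟨-, -, x, y, u, best, rb, qb, hs, -, hbest⟩, ht⟩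
    refine ⟨_, _, _, _, _, _, _, _, hs, ⟨fun r' q hD hq hqm hv => ?_, hbest.attained⟩⟩
    have hmj : m + 1 ≤ j := by simpa [Test.Holds, IntExpr.eval, hs.pos, hs.size] using ht
    refine hbest.le r' q ?_ hq hqm hv
    omega

theorem Ordered.search (hsb : ∑ p ∈ Finset.range m, b p = 1) (hnm : n ≤ m)
    (hs : Ordered m n o a b s) (hpow : ∀ k ≤ n, s.int 3 k = 2 ^ k) :
    Runs search s (300 * 2 ^ n * (m + 1)) (fun s => ∃ r rem p x y u v best rb qb,
      Searching m n o a b r rem p x y u v best rb qb s ∧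
      IsBest a b m n (fun r _ => r < 2 ^ n) best rb qb) := by
  have hstart : Runs (.seq (assignInt 8 (.const 0)) (assignReal 12 (.const 3))) s 6
      (fun s => 0 ≤ 2 ^ n ∧ ∃ rem p x y u v best rb qb,
        Searching m n o a b 0 rem p x y u v best rb qb s ∧
        IsBest a b m n (fun r _ => r < 0) best rb qb) := by
    refine Program.LoopFree.runs (P := .seq (assignInt 8 (.const 0)) (assignReal 12 (.const 3)))
      (by exact ⟨trivial, trivial⟩) ⟨Nat.zero_le _, _, _, _, _, _, _, 3, _, _,
        ⟨?_, hpow, ?_, rfl, rfl, rfl, rfl, rfl, rfl, ?_, rfl, rfl⟩, ?_⟩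
    · obtain ⟨h1, h2, h3, h4, h5⟩ := hs
      exact ⟨h1, h2, h3, h4, h5⟩
    · simp [Program.apply, IntExpr.eval]
    · simp [Program.apply, IntExpr.eval, RealExpr.eval]
    -- The initial best cost 3 acts as infinity: no social cost exceeds 2.
    · exact ⟨fun r q hD => by omega, Or.inl rfl⟩
  refine (hstart.seq fun s hs => Runs.while (T := 100 * (n + 1) + (120 * (m + 1) + 6)) (fun k s =>
    k ≤ 2 ^ n ∧ ∃ rem p x y u v best rb qb,
        Searching m n o a b k rem p x y u v best rb qb s ∧
        IsBest a b m n (fun r _ => r < k) best rb qb) (2 ^ n) ?_ ?_ (Nat.zero_le _) hs).mono ?_ ?_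
  · rintro k s ⟨-, rem, p, x, y, u, v, best, rb, qb, hs, -⟩ ht
    simpa [Test.Holds, IntExpr.eval, hs.round, hs.large, hs.pow n le_rfl] using ht
  · rintro k s ⟨-, rem, p, x, y, u, v, best, rb, qb, hs, hbest⟩ ht
    have hk : k < 2 ^ n := by
      simpa [Test.Holds, IntExpr.eval, hs.round, hs.large, hs.pow n le_rfl] using ht
    refine (hs.assignLarge hk).seq fun s hs => (hs.sweep hsb hnm hk hbest).seq ?_
    rintro s ⟨p, x, y, u, v, best, rb, qb, hs, hbest⟩
    refine Program.LoopFree.runs (P := incr 8) trivial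
      ⟨hk, 0, p, x, y, u, v, best, rb, qb, ?_, hbest⟩
    obtain ⟨⟨h1, h2, h3, h4, h5⟩, h6, h7, h8, h9, h10, h11, h12, h13, h14, h15, h16⟩ := hs
    refine ⟨⟨h1, h2, h3, h4, h5⟩, h6, ?_, h8, h9, h10, h11, h12, h13, h14, h15, h16⟩
    simp [Program.apply, IntExpr.eval, h7]
  · simp only [show (Test.intLT (ivar 8) (.get 3 (ivar 7))).steps = 6 from rfl, Nat.sub_zero]
    have h1 : 1 ≤ 2 ^ n := Nat.one_le_two_pow
    -- Decoding the large positions takes time linear in `n`, which is absorbed by the sweep.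
    have h2 : 2 ^ n * n ≤ 2 ^ n * m := Nat.mul_le_mul_left _ hnm
    nlinarith
  · rintro s ⟨j, -, ⟨hj, rem, p, x, y, u, v, best, rb, qb, hs, hbest⟩, ht⟩
    have : 2 ^ n ≤ j := by
      simpa [Test.Holds, IntExpr.eval, hs.round, hs.large, hs.pow n le_rfl] using ht
    obtain rfl : j = 2 ^ n := le_antisymm hj this
    exact ⟨_, _, _, _, _, _, _, _, _, _, hs, hbest⟩

theorem Searching.emit (hs : Searching m n o a b r rem p x y u v best rb qb s) (k : ℕ) :
    Searching m n o a b r rem p x y u v best rb qb ((emit k).apply s) := by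
  obtain ⟨⟨h1, h2, h3, h4, h5⟩, h6, h7, h8, h9, h10, h11, h12, h13, h14, h15, h16⟩ := hs
  exact ⟨⟨h1, h2, h3, h4, h5⟩, h6, h7, h8, h9, h10, h11, h12, h13, h14, h15, h16⟩

theorem Searching.emit_int (hs : Searching m n o a b r rem p x y u v best rb qb s) (k : ℕ) :
    ((RealRAM.emit k).apply s).int 1 = Function.update (s.int 1) (o p) k := by
  simp [Program.apply, IntExpr.eval, hs.order, hs.pos]

/-- Injectivity of the order ensures that later rounds do not overwrite agents already written. -/
theorem Searching.output (hs : Searching m n o a b r rem p x y u v best rb qb s)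
    (hrb : rb < 2 ^ n) (ho : ∀ p q, p < q → q < m → o p ≠ o q) :
    Runs output s (100 * (m + 1))
      (fun s => ∀ p < m, s.int 1 (o p) = if cut n (bits n rb) qb p then 1 else 0) := by
  have hstart : Runs (.seq (assignInt 9 (ivar 11)) (assignInt 10 (.const 0))) s 7
      (fun s => 0 ≤ m ∧ Searching m n o a b r (rb % 2 ^ (n - 0)) 0 x y u v best rb qb s ∧
        ∀ p < 0, s.int 1 (o p) = if cut n (bits n rb) qb p then 1 else 0) := by
    refine Program.LoopFree.runs (P := .seq (assignInt 9 (ivar 11)) (assignInt 10 (.const 0)))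
      (by exact ⟨trivial, trivial⟩) ⟨Nat.zero_le _, ?_, fun p hp => by omega⟩
    obtain ⟨⟨h1, h2, h3, h4, h5⟩, h6, h7, h8, h9, h10, h11, h12, h13, h14, h15, h16⟩ := hs
    refine ⟨⟨h1, h2, h3, h4, h5⟩, h6, h7, ?_, ?_, h10, h11, h12, h13, h14, h15, h16⟩ <;>
      simp [Program.apply, IntExpr.eval, h15, Nat.mod_eq_of_lt hrb]
  refine (hstart.seq fun s hs => Runs.while (T := 70) (fun k s => k ≤ m ∧
    Searching m n o a b r (rb % 2 ^ (n - k)) k x y u v best rb qb s ∧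
      ∀ p < k, s.int 1 (o p) = if cut n (bits n rb) qb p then 1 else 0) m ?_ ?_
      (Nat.zero_le m) hs).mono ?_ ?_
  · rintro k s ⟨-, hs, -⟩ ht
    simpa [Test.Holds, IntExpr.eval, hs.pos, hs.size] using ht
  · rintro k s ⟨-, hs, hout⟩ ht
    have hkm : k < m := by simpa [Test.Holds, IntExpr.eval, hs.pos, hs.size] using ht
    have hnext : ∀ s', Searching m n o a b r (rb % 2 ^ (n - (k + 1))) k x y u v best rb qb s' →
        s'.int 1 = Function.update (s.int 1) (o k) (if cut n (bits n rb) qb k then 1 else 0) →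
        k + 1 ≤ m ∧ Searching m n o a b r (rb % 2 ^ (n - (k + 1))) (k + 1) x y u v best rb qb
          ((RealRAM.incr 10).apply s') ∧ ∀ p < k + 1, ((RealRAM.incr 10).apply s').int 1 (o p) =
            if cut n (bits n rb) qb p then 1 else 0 := by
      intro s' hs' h1
      refine ⟨hkm, hs'.incr, fun p hp => ?_⟩
      have h2 : ((RealRAM.incr 10).apply s').int 1 = s'.int 1 := by simp [Program.apply]
      rw [h2, h1]
      rcases Nat.lt_succ_iff_lt_or_eq.1 hp with hp | rfl
      · rw [Function.update_of_ne (ho p k hp hkm), hout p hp]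
      · rw [Function.update_self]
    refine Runs.mono (Program.LoopFree.runs (by
      exact ⟨⟨⟨trivial, trivial, trivial⟩, trivial, trivial⟩, trivial⟩)
      (R := fun s => k + 1 ≤ m ∧
        Searching m n o a b r (rb % 2 ^ (n - (k + 1))) (k + 1) x y u v best rb qb s ∧
        ∀ p < k + 1, s.int 1 (o p) = if cut n (bits n rb) qb p then 1 else 0) ?_) (by decide)
      fun s hs => hs
    rw [Program.apply_seq]
    refine hnext _ ?_ ?_
    all_goals
      have hlarge : (Test.intLT (ivar 10) (ivar 7)).Holds s ↔ k < n := by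
        simp [Test.Holds, IntExpr.eval, hs.pos, hs.large]
      have hcut : (Test.intLT (ivar 10) (ivar 12)).Holds s ↔ k < qb := by
        simp [Test.Holds, IntExpr.eval, hs.pos, hs.bestCut]
    · by_cases hkn : k < n
      · rw [Program.apply_ite_pos (hlarge.2 hkn)]
        have hbit := hs.holds_bitIsZero hkn
        cases hB : bits n rb k with
        | false =>
          rw [Program.apply_ite_pos (hbit.2 hB), mod_of_bits_eq_false hkn hB]
          exact hs.emit 0
        | true =>
          rw [Program.apply_ite_neg (fun hc => by simp [hbit.1 hc] at hB),
            mod_of_bits_eq_true hkn hB, Program.apply_seq]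
          have hs := hs.emit 1
          have hpw := hs.eval_currentPower
          generalize (RealRAM.emit 1).apply s = s' at hs hpw ⊢
          obtain ⟨⟨h1, h2, h3, h4, h5⟩, h6, h7, h8, h9, h10, h11, h12, h13, h14, h15, h16⟩ := hs
          refine ⟨⟨h1, h2, h3, h4, h5⟩, h6, h7, ?_, h9, h10, h11, h12, h13, h14, h15, h16⟩
          have he : (IntExpr.sub (ivar 9) currentPower).eval s' =
              rb % 2 ^ (n - k) - 2 ^ (n - 1 - k) := by
            rw [← hpw, ← h8]; rfl
          rw [Program.apply, he]
          simp [IntExpr.eval]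
      · rw [Program.apply_ite_neg (fun hc => hkn (hlarge.1 hc)), show n - (k + 1) = n - k by omega]
        by_cases hkq : k < qb
        · rw [Program.apply_ite_pos (hcut.2 hkq)]
          exact hs.emit 0
        · rw [Program.apply_ite_neg (fun hc => hkq (hcut.1 hc))]
          exact hs.emit 1
    · by_cases hkn : k < n
      · rw [Program.apply_ite_pos (hlarge.2 hkn)]
        have hbit := hs.holds_bitIsZero hkn
        cases hB : bits n rb k with
        | false =>
          rw [Program.apply_ite_pos (hbit.2 hB), hs.emit_int]
          simp [cut, hkn, hB]
        | true =>
          rw [Program.apply_ite_neg (fun hc => by simp [hbit.1 hc] at hB), Program.apply_seq]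
          have h1 : ∀ s' : State,
              ((assignInt 9 (.sub (ivar 9) currentPower)).apply s').int 1 = s'.int 1 :=
            fun s' => by simp [Program.apply]
          rw [h1, hs.emit_int]
          simp [cut, hkn, hB]
      · rw [Program.apply_ite_neg (fun hc => hkn (hlarge.1 hc))]
        by_cases hkq : k < qb
        · rw [Program.apply_ite_pos (hcut.2 hkq), hs.emit_int]
          simp [cut, hkn, not_le.2 hkq]
        · rw [Program.apply_ite_neg (fun hc => hkq (hcut.1 hc)), hs.emit_int]
          simp [cut, hkn, not_lt.1 hkq]
  · simp only [show (Test.intLT (ivar 10) (ivar 0)).steps = 5 from rfl]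
    omega
  · rintro s ⟨j, -, ⟨hjm, hs, hout⟩, ht⟩
    have : m ≤ j := by simpa [Test.Holds, IntExpr.eval, hs.pos, hs.size] using ht
    exact fun p hp => hout p (by omega)

end RealRAM

namespace RealRAM

open TwoAgents

/-! ### Allocations and assignments of positions -/

section Represents

variable {m : ℕ} {I : ChoreInstance 2 m} {o : ℕ → ℕ} {a b : ℕ → ℝ} {α : ℕ → Bool}
  {A : Allocation 2 m}

/-- The order `o` enumerates the items, and `a` and `b` list their costs in this order. -/
structure Enumerates (I : ChoreInstance 2 m) (o : ℕ → ℕ) (a b : ℕ → ℝ) : Prop where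
  lt : ∀ p < m, o p < m
  inj : ∀ p q, p < q → q < m → o p ≠ o q
  surj : ∀ i < m, ∃ p < m, o p = i
  cost₁ : ∀ p (hp : p < m), a p = I.itemCost 0 ⟨o p, lt p hp⟩
  cost₂ : ∀ p (hp : p < m), b p = I.itemCost 1 ⟨o p, lt p hp⟩

/-- The allocation `A` gives the item in position `p` to the agent determined by `α p`. -/
def Represents (o : ℕ → ℕ) (α : ℕ → Bool) (A : Allocation 2 m) : Prop :=
  ∀ p < m, ∀ i : Fin m, o p = i → A i = if α p then 1 else 0

theorem Enumerates.sum_eq (hI : Enumerates I o a b) (f : Fin m → ℝ) (g : ℕ → ℝ)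
    (hfg : ∀ p (hp : p < m), g p = f ⟨o p, hI.lt p hp⟩) :
    ∑ p ∈ Finset.range m, g p = ∑ i, f i := by
  refine Finset.sum_bij (fun p hp => ⟨o p, hI.lt p (Finset.mem_range.1 hp)⟩) (fun _ _ =>
    Finset.mem_univ _) ?_ ?_ (fun p hp => hfg p (Finset.mem_range.1 hp))
  · intro p hp q hq h
    have h : o p = o q := congrArg Fin.val h
    rw [Finset.mem_range] at hp hq
    rcases lt_trichotomy p q with hlt | heq | hlt
    · exact absurd h (hI.inj p q hlt hq)
    · exact heq
    · exact absurd h.symm (hI.inj q p hlt hp)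
  · intro i _
    obtain ⟨p, hp, hi⟩ := hI.surj i i.2
    exact ⟨p, Finset.mem_range.2 hp, Fin.ext hi⟩

theorem Enumerates.sum_cost₁ (hI : Enumerates I o a b) : ∑ p ∈ Finset.range m, a p = 1 :=
  (hI.sum_eq _ _ hI.cost₁).trans (I.normalized 0)

theorem Enumerates.sum_cost₂ (hI : Enumerates I o a b) : ∑ p ∈ Finset.range m, b p = 1 :=
  (hI.sum_eq _ _ hI.cost₂).trans (I.normalized 1)

theorem Represents.cost_zero (hA : Represents o α A) (hI : Enumerates I o a b) :
    I.cost 0 (Allocation.bundle A 0) = load₁ a α m := by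
  rw [ChoreInstance.cost, Allocation.bundle, Finset.sum_filter]
  refine (hI.sum_eq _ _ fun p hp => ?_).symm
  rw [hA p hp _ rfl, share₁, hI.cost₁ p hp]
  cases α p <;> simp

theorem Represents.cost_one (hA : Represents o α A) (hI : Enumerates I o a b) :
    I.cost 1 (Allocation.bundle A 1) = load₂ b α m := by
  rw [ChoreInstance.cost, Allocation.bundle, Finset.sum_filter]
  refine (hI.sum_eq _ _ fun p hp => ?_).symm
  rw [hA p hp _ rfl, share₂, hI.cost₂ p hp]
  cases α p <;> simp

theorem Represents.socialCost (hA : Represents o α A) (hI : Enumerates I o a b) :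
    I.socialCost A = total a b m α := by
  rw [ChoreInstance.socialCost, Fin.sum_univ_two, hA.cost_zero hI, hA.cost_one hI, total]

theorem cost_sdiff_singleton {i : Fin 2} {x : Fin m} {S : Finset (Fin m)} (hx : x ∈ S) :
    I.cost i (S \ {x}) = I.cost i S - I.itemCost i x := by
  rw [ChoreInstance.cost, ChoreInstance.cost, Finset.sum_eq_add_sum_sdiff_singleton_of_mem hx]
  ring

/-- Costs are nonnegative, so an empty bundle satisfies the inequality without removal. Conversely,
if no removal is needed, removing any item of a nonempty bundle does no harm. -/
theorem empty_or_exists_iff {i j : Fin 2} {S T : Finset (Fin m)} :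
    (S = ∅ ∨ ∃ x ∈ S, I.cost i (S \ {x}) ≤ I.cost j T) ↔
      (I.cost i S ≤ I.cost j T ∨ ∃ x ∈ S, I.cost i S - I.itemCost i x ≤ I.cost j T) := by
  have hT : 0 ≤ I.cost j T := Finset.sum_nonneg fun x _ => I.itemCost_nonneg j x
  constructor
  · rintro (rfl | ⟨x, hx, h⟩)
    · left
      simpa [ChoreInstance.cost] using hT
    · exact Or.inr ⟨x, hx, cost_sdiff_singleton hx ▸ h⟩
  · rintro (h | ⟨x, hx, h⟩)
    · rcases S.eq_empty_or_nonempty with hS | ⟨x, hx⟩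
      · exact Or.inl hS
      · refine Or.inr ⟨x, hx, ?_⟩
        rw [cost_sdiff_singleton hx]
        have := I.itemCost_nonneg i x
        linarith
    · exact Or.inr ⟨x, hx, (cost_sdiff_singleton hx).symm ▸ h⟩

theorem eq1_iff : I.EQ1 A ↔ ∀ i j : Fin 2, i ≠ j →
    (I.cost i (A.bundle i) ≤ I.cost j (A.bundle j) ∨
      ∃ x ∈ A.bundle i, I.cost i (A.bundle i) - I.itemCost i x ≤ I.cost j (A.bundle j)) := by
  unfold ChoreInstance.EQ1
  simp only [empty_or_exists_iff]
  refine ⟨fun h i j _ => h i j, fun h i j => ?_⟩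
  by_cases hij : i = j
  · subst hij
    exact Or.inl le_rfl
  · exact h i j hij

theorem Represents.mem_bundle (hA : Represents o α A) (hI : Enumerates I o a b) {p : ℕ} (hp : p < m)
    (k : Fin 2) : ⟨o p, hI.lt p hp⟩ ∈ Allocation.bundle A k ↔ (if α p then 1 else 0) = k := by
  have h := hA p hp ⟨o p, hI.lt p hp⟩ rfl
  simp [Allocation.bundle, h]

theorem Represents.eq1_iff (hA : Represents o α A) (hI : Enumerates I o a b) :
    I.EQ1 A ↔ EQ1 a b m α := by
  have h1 : (∃ x ∈ A.bundle 0, load₁ a α m - I.itemCost 0 x ≤ load₂ b α m) ↔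
      ∃ p < m, α p = false ∧ load₁ a α m - a p ≤ load₂ b α m := by
    constructor
    · rintro ⟨x, hx, h⟩
      obtain ⟨p, hp, hpx⟩ := hI.surj x x.2
      obtain rfl : (⟨o p, hI.lt p hp⟩ : Fin m) = x := Fin.ext hpx
      rw [hA.mem_bundle hI hp] at hx
      exact ⟨p, hp, by simpa using hx, hI.cost₁ p hp ▸ h⟩
    · rintro ⟨p, hp, hα, h⟩
      exact ⟨_, (hA.mem_bundle hI hp 0).2 (by simp [hα]), hI.cost₁ p hp ▸ h⟩
  have h2 : (∃ x ∈ A.bundle 1, load₂ b α m - I.itemCost 1 x ≤ load₁ a α m) ↔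
      ∃ p < m, α p = true ∧ load₂ b α m - b p ≤ load₁ a α m := by
    constructor
    · rintro ⟨x, hx, h⟩
      obtain ⟨p, hp, hpx⟩ := hI.surj x x.2
      obtain rfl : (⟨o p, hI.lt p hp⟩ : Fin m) = x := Fin.ext hpx
      rw [hA.mem_bundle hI hp] at hx
      exact ⟨p, hp, by simpa using hx, hI.cost₂ p hp ▸ h⟩
    · rintro ⟨p, hp, hα, h⟩
      exact ⟨_, (hA.mem_bundle hI hp 1).2 (by simp [hα]), hI.cost₂ p hp ▸ h⟩
  rw [RealRAM.eq1_iff, EQ1, ← h1, ← h2, ← hA.cost_zero hI, ← hA.cost_one hI]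
  constructor
  · exact fun h => ⟨h 0 1 (by decide), h 1 0 (by decide)⟩
  · rintro ⟨h0, h1⟩ i j hij
    fin_cases i <;> fin_cases j
    · exact absurd rfl hij
    · exact h0
    · exact h1
    · exact absurd rfl hij

theorem exists_represents_of_allocation (A : Allocation 2 m) (o : ℕ → ℕ) :
    ∃ α : ℕ → Bool, Represents o α A := by
  refine ⟨fun p => if h : o p < m then decide (A ⟨o p, h⟩ = 1) else false, fun p _ i hi => ?_⟩
  obtain ⟨i, him⟩ := i
  have hi : o p = i := hi
  subst hi
  simp only [him, dite_true, decide_eq_true_eq]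
  generalize A ⟨o p, him⟩ = k
  fin_cases k <;> simp

theorem Enumerates.exists_allocation (hI : Enumerates I o a b) (α : ℕ → Bool) :
    ∃ A : Allocation 2 m, Represents o α A := by
  choose f hf hof using hI.surj
  refine ⟨fun i => if α (f i i.2) then 1 else 0, fun p hp i hi => ?_⟩
  have : f i i.2 = p := by
    have h := (hof i i.2).trans hi.symm
    rcases lt_trichotomy (f i i.2) p with hlt | heq | hlt
    · exact absurd h (hI.inj _ _ hlt hp)
    · exact heq
    · exact absurd h.symm (hI.inj _ _ hlt (hf i i.2))
  simp only [this]

end Represents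

theorem total_le {a b : ℕ → ℝ} (ha : ∀ p, 0 ≤ a p) (hb : ∀ p, 0 ≤ b p) (m : ℕ) (α : ℕ → Bool) :
    total a b m α ≤ ∑ p ∈ Finset.range m, (a p + b p) := by
  rw [total, load₁, load₂, ← Finset.sum_add_distrib]
  refine Finset.sum_le_sum fun p _ => ?_
  have := ha p
  have := hb p
  unfold share₁ share₂
  split_ifs <;> linarith

/-! ### The ordered items -/

/-- By counting, a duplicate-free list of at least `m` numbers below `m` is a permutation of
`List.range m`. -/
theorem enumerates_of_nodup {m : ℕ} {I : ChoreInstance 2 m} {c₁ c₂ : ℕ → ℝ} {l : List ℕ}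
    (hc₁ : ∀ i : Fin m, c₁ i = I.itemCost 0 i) (hc₂ : ∀ i : Fin m, c₂ i = I.itemCost 1 i)
    (hl : l.Nodup) (hlt : ∀ i ∈ l, i < m) (hm : m ≤ l.length) :
    l.length = m ∧ Enumerates I (fun k => l.getD k 0) (fun k => (l.map c₁).getD k 0)
      (fun k => (l.map c₂).getD k 0) := by
  have hsub : l.Subperm (List.range m) :=
    List.subperm_of_subset hl fun i hi => List.mem_range.2 (hlt i hi)
  have hlen : l.length = m := le_antisymm (by simpa using hsub.length_le) hm
  have hperm : l.Perm (List.range m) := hsub.perm_of_length_le (by simpa using hm)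
  have hget : ∀ p (hp : p < l.length) (d : ℕ), l.getD p d = l[p] := fun p hp d => by simp [hp]
  have hlt' : ∀ p < m, l.getD p 0 < m := fun p hp => by
    rw [hget p (by omega)]
    exact hlt _ (List.getElem_mem _)
  refine ⟨hlen, hlt', ?_, ?_, ?_, ?_⟩
  · intro p q hpq hq h
    rw [hget p (by omega), hget q (by omega), hl.getElem_inj_iff] at h
    omega
  · intro i hi
    obtain ⟨p, hp, h⟩ := List.getElem_of_mem (hperm.mem_iff.2 (List.mem_range.2 hi))
    exact ⟨p, by omega, (hget p hp 0).trans h⟩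
  · intro p hp
    rw [← hc₁]
    simp [show p < l.length by omega]
  · intro p hp
    rw [← hc₂]
    simp [show p < l.length by omega]

/-- The order consists of `n` large positions, followed by approximately sorted small ones. -/
structure Sorted (m n : ℕ) (e h : ℝ) (a b : ℕ → ℝ) : Prop where
  le : n ≤ m
  large : ∀ p < n, e ≤ a p + b p
  small : ∀ p, n ≤ p → p < m → a p + b p < e
  sort : ∀ p q, n ≤ p → p < q → q < m →
    ∃ θ : ℝ, θ * (a p + b p) ≤ b p - a p ∧ b q - a q ≤ (θ + h) * (a q + b q)

theorem sorted_append_smallItems {m : ℕ} {c₁ c₂ : ℕ → ℝ} {e h : ℝ} {j : ℕ} (hh : 0 ≤ h)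
    (hc₁ : ∀ i, 0 ≤ c₁ i) (hc₂ : ∀ i, 0 ≤ c₂ i)
    (hlen : (largeItems m c₁ c₂ e ++ smallItems m c₁ c₂ h (largeItems m c₁ c₂ e) j).length = m)
    (hnodup : (largeItems m c₁ c₂ e ++ smallItems m c₁ c₂ h (largeItems m c₁ c₂ e) j).Nodup) :
    Sorted m (largeItems m c₁ c₂ e).length e h
      (fun k => ((largeItems m c₁ c₂ e ++
        smallItems m c₁ c₂ h (largeItems m c₁ c₂ e) j).map c₁).getD k 0)
      (fun k => ((largeItems m c₁ c₂ e ++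
        smallItems m c₁ c₂ h (largeItems m c₁ c₂ e) j).map c₂).getD k 0) := by
  set L := largeItems m c₁ c₂ e with hL
  set S := smallItems m c₁ c₂ h L j with hS
  have hget : ∀ (c : ℕ → ℝ) p (hp : p < (L ++ S).length),
      ((L ++ S).map c).getD p 0 = c (L ++ S)[p] := fun c p hp => by
    rw [List.getD_eq_getElem _ _ (by simpa using hp), List.getElem_map]
  have hgetS : ∀ p (hn : L.length ≤ p) (hp : p < (L ++ S).length),
      (L ++ S)[p] = S[p - L.length]'(by rw [List.length_append] at hp; omega) :=
    fun p hn hp => List.getElem_append_right hn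
  have hle : L.length ≤ m := by rw [← hlen, List.length_append]; omega
  refine ⟨hle, ?_, ?_, ?_⟩
  · intro p hp
    rw [hget _ p (by omega), hget _ p (by omega), List.getElem_append_left hp]
    have := (List.mem_filter.1 (List.getElem_mem hp)).2
    simpa using this
  · intro p hn hp
    rw [hget _ p (by omega), hget _ p (by omega), hgetS p hn (by omega)]
    have hmem : S[p - L.length]'(by rw [List.length_append] at hlen; omega) ∈ S :=
      List.getElem_mem _
    generalize S[p - L.length]'(by rw [List.length_append] at hlen; omega) = i at hmem
    by_contra hc
    have : i ∈ L := List.mem_filter.2 ⟨List.mem_range.2 (lt_of_mem_smallItems hmem), by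
      simpa using hc⟩
    exact (List.disjoint_of_nodup_append hnodup) this hmem
  · intro p q hn hpq hq
    rw [hget _ p (by omega), hget _ p (by omega), hget _ q (by omega), hget _ q (by omega),
      hgetS p hn (by omega), hgetS q (by omega) (by omega)]
    exact List.pairwise_iff_getElem.1 (pairwise_smallItems hh hc₁ hc₂ j) _ _ _ _ (by omega)

/-! ### The algorithm -/

/-- Compute the bound for large items, the bucket width and the first level. -/
def setup : Program :=
  .seq (assignReal 5 (.div (rvar 0) (.add (.const 1) (rvar 0)))) <|
  .seq (assignReal 6 (.div (.mul (rvar 0) (rvar 0)) (.mul (.const 2) (.add (.const 1) (rvar 0))))) <|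
  assignReal 7 (.const 1)

/-- The approximation scheme. -/
def scheme : Program := .seq setup (.seq arrange (.seq powers (.seq search output)))

variable {m : ℕ} {I : ChoreInstance 2 m} {ε : ℝ}

theorem input_real_one (I : ChoreInstance 2 m) (ε : ℝ) (i : Fin m) :
    (input I ε).real 1 i = I.itemCost 0 i := by
  simp [input]

theorem input_real_two (I : ChoreInstance 2 m) (ε : ℝ) (i : Fin m) :
    (input I ε).real 2 i = I.itemCost 1 i := by
  simp [input]

theorem input_real_one_nonneg (I : ChoreInstance 2 m) (ε : ℝ) (i : ℕ) :
    0 ≤ (input I ε).real 1 i := by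
  by_cases h : i < m
  · exact (input_real_one I ε ⟨i, h⟩).symm ▸ I.itemCost_nonneg 0 ⟨i, h⟩
  · simp [input, h]

theorem input_real_two_nonneg (I : ChoreInstance 2 m) (ε : ℝ) (i : ℕ) :
    0 ≤ (input I ε).real 2 i := by
  by_cases h : i < m
  · exact (input_real_two I ε ⟨i, h⟩).symm ▸ I.itemCost_nonneg 1 ⟨i, h⟩
  · simp [input, h]

theorem runs_setup (I : ChoreInstance 2 m) (ε : ℝ) :
    Runs setup (input I ε) setup.cost (Arranged m ((input I ε).real 1) ((input I ε).real 2)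
      (ε / (1 + ε)) (ε * ε / (2 * (1 + ε))) 1 0 []) := by
  refine Program.LoopFree.runs (by exact ⟨trivial, trivial, trivial⟩) ?_
  constructor <;> simp [setup, Program.apply, IntExpr.eval, RealExpr.eval] <;> simp [input]

/-- A constant in the running time of the ordering phase. -/
def arrangeCost : ℕ := scanCost isLarge + scanCost isNext + 30

theorem runs_scheme (hε : 0 < ε) {N : ℕ} (hN : 2 ≤ N * (ε * ε / (2 * (1 + ε)))) :
    ∃ (n : ℕ) (s : State) (t : ℕ) (A : Allocation 2 m), Exec scheme (input I ε) s t ∧ n ≤ m ∧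
      n * (ε / (1 + ε)) ≤ 2 ∧
      t ≤ setup.cost + (arrangeCost * (N + 3) * (m + 1) + (30 * (n + 1) +
        (300 * 2 ^ n * (m + 1) + 100 * (m + 1)))) ∧
      IsOutput s A ∧ I.EQ1 A ∧ ∀ A', I.EQ1 A' → I.socialCost A ≤ I.socialCost A' + ε := by
  set c₁ := (input I ε).real 1 with hc₁
  set c₂ := (input I ε).real 2 with hc₂
  set e := ε / (1 + ε) with he
  set h := ε * ε / (2 * (1 + ε)) with hh
  have he0 : 0 ≤ e := by positivity
  have hh0 : 0 ≤ h := by positivity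
  -- The error budget: `e` for the granularity of the cuts and `2 * h` for the approximate sorting.
  have heh : e + 2 * h = ε := by rw [he, hh]; field_simp
  have hc₁0 : ∀ i, 0 ≤ c₁ i := input_real_one_nonneg I ε
  have hc₂0 : ∀ i, 0 ≤ c₂ i := input_real_two_nonneg I ε
  obtain ⟨s₁, t₁, hx₁, ht₁, hs₁⟩ := runs_setup I ε
  obtain ⟨s₂, t₂, hx₂, ht₂, j, θ, hs₂, hm⟩ := hs₁.arrange hh0 hN hc₁0 hc₂0
  set L := largeItems m c₁ c₂ e with hL
  set l := L ++ smallItems m c₁ c₂ h L j with hl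
  have hnodup : l.Nodup := nodup_append_smallItems (List.nodup_range.filter _) j
  have hlt : ∀ i ∈ l, i < m := fun i hi => (List.mem_append.1 hi).elim
    (fun hi => List.mem_range.1 (List.mem_filter.1 hi).1) lt_of_mem_smallItems
  obtain ⟨hlen, henum⟩ := enumerates_of_nodup (input_real_one I ε) (input_real_two I ε) hnodup hlt hm
  have hsorted := sorted_append_smallItems hh0 hc₁0 hc₂0 hlen hnodup
  have hord : Ordered m L.length (fun k => l.getD k 0) (fun k => (l.map c₁).getD k 0)
    (fun k => (l.map c₂).getD k 0) s₂ := ⟨hs₂.size, hs₂.large, hs₂.order, hs₂.list₁, hs₂.list₂⟩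
  have hnonneg : ∀ c : ℕ → ℝ, (∀ i, 0 ≤ c i) → ∀ p, 0 ≤ (l.map c).getD p 0 := by
    intro c hc p
    rcases lt_or_ge p (l.map c).length with hp | hp
    · rw [List.getD_eq_getElem _ _ hp, List.getElem_map]
      exact hc _
    · rw [List.getD_eq_default _ _ hp]
  have ha : ∀ p, 0 ≤ (fun k => (l.map c₁).getD k 0) p := hnonneg c₁ hc₁0
  have hb : ∀ p, 0 ≤ (fun k => (l.map c₂).getD k 0) p := hnonneg c₂ hc₂0
  -- The cell just past the list holds the default 0, as required for the cut at `m`.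
  have hbm : (fun k => (l.map c₂).getD k 0) m = 0 :=
    List.getD_eq_default _ _ (by rw [List.length_map, hlen])
  change Enumerates I _ (fun k => (l.map c₁).getD k 0) (fun k => (l.map c₂).getD k 0) at henum
  change Sorted m _ e h (fun k => (l.map c₁).getD k 0) (fun k => (l.map c₂).getD k 0) at hsorted
  generalize (fun k => (l.map c₁).getD k 0) = a at *
  generalize (fun k => (l.map c₂).getD k 0) = b at *
  generalize (fun k => l.getD k 0) = o at *
  generalize L.length = n at *
  have hsum : ∑ p ∈ Finset.range m, (a p + b p) = 2 := by
    rw [Finset.sum_add_distrib, henum.sum_cost₁, henum.sum_cost₂]; norm_num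
  have hne : n * e ≤ 2 := by
    have h1 : ∑ p ∈ Finset.range n, e ≤ ∑ p ∈ Finset.range n, (a p + b p) :=
      Finset.sum_le_sum fun p hp => hsorted.large p (Finset.mem_range.1 hp)
    have h2 : ∑ p ∈ Finset.range n, (a p + b p) ≤ ∑ p ∈ Finset.range m, (a p + b p) :=
      Finset.sum_le_sum_of_subset_of_nonneg (Finset.range_subset_range.2 hsorted.le)
        fun p _ _ => add_nonneg (ha p) (hb p)
    rw [Finset.sum_const, Finset.card_range, nsmul_eq_mul] at h1
    linarith
  obtain ⟨s₃, t₃, hx₃, ht₃, hs₃, hpow⟩ := hord.powers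
  obtain ⟨s₄, t₄, hx₄, ht₄, r, rem, p, x, y, u, v, best, rb, qb, hs₄, hbest⟩ :=
    hs₃.search henum.sum_cost₂ hsorted.le hpow
  have hcand : ∀ α, EQ1 a b m α → best ≤ total a b m α + ε ∧ best ≤ 2 := by
    intro α hα
    obtain ⟨q, hnq, hqm, hv, hq⟩ := exists_valid_cut he0 hh0 ha hb hsum.le hsorted.le
      hsorted.small hsorted.sort hα
    obtain ⟨r', hr', hbits⟩ := exists_bits_eq n α
    have hle := hbest.le r' q hr' hnq hqm
    have htl := total_le ha hb m (cut n α q)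
    rw [Valid, cut_congr hbits] at hle
    have := hle hv
    constructor <;> linarith
  -- Some EQ1 assignment exists and is matched by a valid cut of cost at most 2, so the initial
  -- value 3 has been replaced.
  obtain ⟨hrb, hnq, hqm, hvalid, htotal⟩ := hbest.attained.resolve_left (by
    rintro rfl
    obtain ⟨α, hα⟩ := exists_eq1 ha hb hbm
    have := (hcand α hα).2
    norm_num at this)
  obtain ⟨s₅, t₅, hx₅, ht₅, hout⟩ := hs₄.output hrb henum.inj
  obtain ⟨A, hA⟩ := henum.exists_allocation (cut n (bits n rb) qb)
  refine ⟨n, s₅, _, A, Exec.seq hx₁ (Exec.seq hx₂ (Exec.seq hx₃ (Exec.seq hx₄ hx₅))), hsorted.le,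
    hne, ?_, ?_, (hA.eq1_iff henum).2 (hvalid.eq1 hnq hqm hbm), ?_⟩
  · unfold arrangeCost
    omega
  · intro i
    obtain ⟨p, hp, hi⟩ := henum.surj i i.2
    rw [← hi, hout p hp, hA p hp i hi]
    split_ifs <;> rfl
  · intro A' hA'
    obtain ⟨α, hα⟩ := exists_represents_of_allocation A' o
    have := (hcand α ((hα.eq1_iff henum).1 hA')).1
    rw [hA.socialCost henum, hα.socialCost henum, htotal]
    exact this

/-- With `x = 2 / ε` the left side bounds the number of passes of the ordering phase, up to an
additive constant. The quadratic Taylor bound for the exponential suffices. -/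
theorem sq_add_le_two_rpow {x : ℝ} (hx : 0 ≤ x) : x ^ 2 + 2 * x + 4 ≤ 12 * (2 : ℝ) ^ x := by
  rw [Real.rpow_def_of_pos (by norm_num)]
  have hl := Real.log_two_gt_d9
  have h0 : 0 ≤ Real.log 2 * x := by positivity
  have h1 := Real.quadratic_le_exp_of_nonneg h0
  have h2 : 0.69 * x ≤ Real.log 2 * x := mul_le_mul_of_nonneg_right (by linarith) hx
  have h3 : (0.69 * x) ^ 2 ≤ (Real.log 2 * x) ^ 2 := pow_le_pow_left₀ (by positivity) h2 2
  nlinarith [sq_nonneg x]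

end RealRAM

/-- Two-agent minimization of the social cost subject to EQ1 has an additive approximation scheme: one
program and one absolute constant serve all accuracies, all numbers of items and all instances. -/
theorem theorem6 :
    ∃ (P : RealRAM.Program) (C : ℝ),
      ∀ (ε : ℝ), 0 < ε → ∀ (m : ℕ) (I : ChoreInstance 2 m),
        ∃ (s : RealRAM.State) (t : ℕ) (A : Allocation 2 m),
          RealRAM.Exec P (RealRAM.input I ε) s t ∧
          (t : ℝ) ≤ C * ((m : ℝ) * (2 : ℝ) ^ (2 / ε)) ∧
          RealRAM.IsOutput s A ∧
          I.EQ1 A ∧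
          I.socialCost A ≤ I.optEQ1 + ε := by
  refine ⟨RealRAM.scheme,
    -- The factor 2 comes from `m + 1 ≤ 2 * m`, the 12 from the bound on the passes, and 1200 is 300
    -- times the 4 in `2 ^ n ≤ 4 * 2 ^ (2 / ε)`.
    2 * (RealRAM.setup.cost + RealRAM.arrangeCost * 12 + 30 + 1200 + 100), fun ε hε m I => ?_⟩
  have hm : 1 ≤ m := by
    rcases Nat.eq_zero_or_pos m with rfl | hm
    · have := I.normalized 0
      simp at this
    · exact hm
  -- This expression is exactly `2 / h`, the number of level drops from ratio 1 to ratio -1.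
  have hceil := Nat.le_ceil ((2 / ε) ^ 2 + 2 * (2 / ε))
  have hceil' := Nat.ceil_lt_add_one (a := (2 / ε) ^ 2 + 2 * (2 / ε)) (by positivity)
  generalize ⌈(2 / ε) ^ 2 + 2 * (2 / ε)⌉₊ = N at hceil hceil'
  have hN : 2 ≤ N * (ε * ε / (2 * (1 + ε))) := by
    refine le_trans (le_of_eq ?_) (mul_le_mul_of_nonneg_right hceil (by positivity))
    field_simp
  obtain ⟨n, s, t, A, hx, hnm, hn, ht, hout, hA, hopt⟩ := RealRAM.runs_scheme (I := I) hε hN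
  refine ⟨s, t, A, hx, ?_, hout, hA, ?_⟩
  · have hx2 := RealRAM.sq_add_le_two_rpow (x := 2 / ε) (by positivity)
    -- Here `2 / e = 2 / ε + 2`: taking `e` slightly below `ε` costs only a factor 4 in `2 ^ n` and
    -- leaves room for the sorting error.
    have hn' : (n : ℝ) ≤ 2 / ε + 2 := by
      rw [← le_div_iff₀ (by positivity)] at hn
      refine hn.trans (le_of_eq ?_)
      field_simp
    have hpow : (2 : ℝ) ^ n ≤ 4 * (2 : ℝ) ^ (2 / ε) := by
      rw [← Real.rpow_natCast]
      refine (Real.rpow_le_rpow_of_exponent_le (by norm_num) hn').trans (le_of_eq ?_)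
      rw [Real.rpow_add (by norm_num)]
      norm_num
      ring
    have hone : (1 : ℝ) ≤ (2 : ℝ) ^ (2 / ε) := Real.one_le_rpow (by norm_num) (by positivity)
    generalize (2 : ℝ) ^ (2 / ε) = E at *
    have ht' : (t : ℝ) ≤ RealRAM.setup.cost + (RealRAM.arrangeCost * (N + 3) * (m + 1) +
        (30 * (n + 1) + (300 * 2 ^ n * (m + 1) + 100 * (m + 1)))) := by exact_mod_cast ht
    have hnm' : (n : ℝ) ≤ m := by exact_mod_cast hnm
    have hm' : (1 : ℝ) ≤ m := by exact_mod_cast hm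
    generalize hS : (RealRAM.setup.cost : ℝ) = S at *
    generalize hK : (RealRAM.arrangeCost : ℝ) = K at *
    have hS0 : 0 ≤ S := hS ▸ Nat.cast_nonneg _
    have hK0 : 0 ≤ K := hK ▸ Nat.cast_nonneg _
    have hmE : (m : ℝ) + 1 ≤ 2 * (m * E) := by nlinarith
    have e1 : S ≤ S * (2 * (m * E)) := le_mul_of_one_le_right hS0 (by linarith)
    have e2 : K * (N + 3) * (m + 1) ≤ K * (12 * E) * (2 * m) := by
      refine mul_le_mul (mul_le_mul_of_nonneg_left (by linarith) hK0) (by linarith) (by linarith)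
        (by positivity)
    have e3 : 300 * (2 : ℝ) ^ n * (m + 1) ≤ 300 * (4 * E) * (2 * m) :=
      mul_le_mul (by linarith) (by linarith) (by linarith) (by positivity)
    nlinarith
  · have : I.socialCost A - ε ≤ I.optEQ1 := by
      refine le_csInf ⟨_, A, hA, rfl⟩ ?_
      rintro _ ⟨A', hA', rfl⟩
      linarith [hopt A' hA']
    linarith
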